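/- Let $I=[0,1]$ and let $\tau:I\to I$ be a surjective unimodal map with critical point $c\in(0,1)$, that is, $\tau$ is continuous and onto, strictly increasing on $[0,c]$ and strictly decreasing on $[c,1]$. Notation. Let $C=\{0,c,1\}$ and let $I_1$ be the smallest subset of $I$ that contains $C$ and is closed under $\tau$ and $\tau^{-1}$. Let $X$ be the totally ordered set obtained from $I$ by replacing each $x\in I_1\setminus\{0,1\}$ by two points $x^-<x^+$, with the order topology; for the other points of $I$ write $x^-=x^+=x$. For $a<b$ in $I_1$ the order interval $[a^+,b^-]_X$ is clopen. Let $\sigma:X\to X$ be the local homeomorphism associated with $\tau$: it maps $[0^+,c^-]_X$ onto $[\tau(0)^+,\tau(c)^-]_X$ preserving the order and $[c^+,1^-]_X$ onto $[\tau(1)^+,\tau(c)^-]_X$ reversing the order, and lies over $\tau$ under the collapse map $X\to I$. Let $(\mathcal L f)(x)=\sum_{\sigma(y)=x}f(y)$ for $f\in C(X,\mathbb Z)$. The dimension group $DG(\tau)$ is the quotient of $C(X,\mathbb Z)$ by the relation $f\sim g\iff \mathcal L^nf=\mathcal L^ng$ for some $n\ge 0$; its positive cone is $DG(\tau)^+=\{[f]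 : f\ge 0\}$, and $\mathcal L_*[f]=[\mathcal L f]$. Since $\tau$ is surjective, $\mathcal L_*$ is an automorphism of $DG(\tau)$, which makes $DG(\tau)$ a $\mathbb Z[t,t^{-1}]$-module with $t$ acting as $\mathcal L_*$ (the dimension module). For $a<b$ in $I_1$ write $I(a,b)\in DG(\tau)$ for the class of the characteristic function of $[a^+,b^-]_X$. A Markov partition for $\tau$ is a sequence $0=b_0<b_1<\dots<b_n=1$ of points of $I_1$ such that for each $i$ the map $\tau$ is monotonic on $(b_{i-1},b_i)$ and $\overline{\tau(b_{i-1},b_i)}$ is a union of intervals $[b_{j-1},b_j]$, and such that $\tau^k(C)\subset\{b_0,\dots,b_n\}$ for some $k\ge 0$; $\tau$ is Markov if it has a Markov partition. With $E_i=[b_{i-1}^+,b_i^-]_X$, the incidence matrix of the partition is the $n\times n$ zero-one matrix $A$ with $A_{ij}=1$ iff $\sigma(E_i)\supset E_j$. For such an $A$, $G_A$ is the stationary inductive limit, in the category of ordered abelian groups, of $\mathbb Z^n\to\mathbb Z^n\to\cdots$ with all connecting maps equal to $v\mapsto vA$ (where $\mathbb Z^n$ has the coordinatewise order), $G_A^+$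 is its positive cone, and $A_*$ is the automorphism of $G_A$ induced by $v\mapsto vA$. The point $c$ is eventually periodic if $\tau^k(c)$ is a periodic point of $\tau$ for some $k\ge 0$. Theorem. (1) The dimension module $DG(\tau)$ is cyclic, with generator $I(0,1)$. (2) If $c$ is eventually periodic, then $\tau$ is Markov, and for every Markov partition of $\tau$, with incidence matrix $A$, the triples $(DG(\tau),DG(\tau)^+,\mathcal L_*)$ and $(G_A,G_A^+,A_*)$ are isomorphic: there is a group isomorphism which carries $DG(\tau)^+$ onto $G_A^+$ and intertwines $\mathcal L_*$ and $A_*$. (3) If $c$ is not eventually periodic, then there is an isomorphism of abelian groups $DG(\tau)\cong\mathbb Z[t,t^{-1}]$ which carries $\mathcal L_*$ to multiplication by $t$. -/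

import Mathlib

open Set Filter
open scoped LaurentPolynomial

namespace IntervalDim

/-! ## Piecewise homeomorphisms, the transfer map and the dimension group -/

section Transfer

variable {X : Type*} [TopologicalSpace X]

/-- A piecewise homeomorphism: a continuous open map for which there is a finite partition of the
space into clopen sets on each of which the map is injective (being continuous and open, it is then
a homeomorphism from each of these sets onto its image). -/
structure IsPiecewiseHomeo (σ : X → X) : Prop where
  continuous : Continuous σ
  isOpenMap : IsOpenMap σ
  exists_partition : ∃ (n : ℕ) (P : Fin n → Set X), (∀ i, IsClopen (P i)) ∧
    Pairwise (fun i j => Disjoint (P i) (P j)) ∧ (⋃ i, P i) = univ ∧ ∀ i, InjOn σ (P i)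

/-- The transfer map `(L f)(x) = ∑_{σ y = x} f y` on functions. -/
noncomputable def transfer (σ : X → X) (f : X → ℤ) : X → ℤ :=
  fun x => ∑ᶠ y ∈ σ ⁻¹' {x}, f y

theorem IsPiecewiseHomeo.finite_fiber {σ : X → X} (h : IsPiecewiseHomeo σ) (x : X) :
    (σ ⁻¹' {x}).Finite := by
  obtain ⟨n, P, -, -, hU, hinj⟩ := h.exists_partition
  have : σ ⁻¹' {x} ⊆ ⋃ i, (P i ∩ σ ⁻¹' {x}) := by
    intro y hy
    have : y ∈ ⋃ i, P i := by rw [hU]; trivial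
    obtain ⟨i, hi⟩ := mem_iUnion.1 this
    exact mem_iUnion.2 ⟨i, hi, hy⟩
  refine Set.Finite.subset (Set.finite_iUnion fun i => Set.Subsingleton.finite ?_) this
  rintro a ⟨ha, ha'⟩ b ⟨hb, hb'⟩
  exact hinj i ha hb (ha'.trans hb'.symm)

theorem IsPiecewiseHomeo.transfer_add {σ : X → X} (h : IsPiecewiseHomeo σ) (f g : X → ℤ) :
    transfer σ (f + g) = transfer σ f + transfer σ g := by
  funext x
  exact finsum_mem_add_distrib (h.finite_fiber x)

theorem IsPiecewiseHomeo.continuous_transfer [CompactSpace X] [T2Space X] {σ : X → X}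
    (h : IsPiecewiseHomeo σ) {f : X → ℤ} (hf : Continuous f) : Continuous (transfer σ f) := by
  obtain ⟨n, P, hP, hdisj, hU, hinj⟩ := h.exists_partition
  have key : transfer σ f = fun x => ∑ i, ∑ᶠ y ∈ P i ∩ σ ⁻¹' {x}, f y := by
    funext x
    have hx : σ ⁻¹' {x} = ⋃ i, (P i ∩ σ ⁻¹' {x}) := by
      rw [← iUnion_inter, hU, univ_inter]
    unfold transfer
    rw [hx, finsum_mem_iUnion, finsum_eq_sum_of_fintype, ← hx]
    · intro i j hij
      exact (hdisj hij).mono inter_subset_left inter_subset_left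
    · intro i
      exact (h.finite_fiber x).subset inter_subset_right
  rw [key]
  refine continuous_finsetSum _ fun i _ => ?_
  have hloc : IsLocallyConstant (fun x => ∑ᶠ y ∈ P i ∩ σ ⁻¹' {x}, f y) := by
    rw [IsLocallyConstant.iff_eventually_eq]
    intro x
    by_cases hx : x ∈ σ '' P i
    · obtain ⟨y, hy, rfl⟩ := hx
      have hval : ∀ z ∈ P i, ∑ᶠ w ∈ P i ∩ σ ⁻¹' {σ z}, f w = f z := by
        intro z hz
        have : P i ∩ σ ⁻¹' {σ z} = {z} := by
          ext w
          constructor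
          · rintro ⟨hw, hw'⟩
            exact hinj i hw hz hw'
          · rintro rfl
            exact ⟨hz, rfl⟩
        rw [this, finsum_mem_singleton]
      have hV : IsOpen (P i ∩ f ⁻¹' {f y}) :=
        (hP i).isOpen.inter ((isOpen_discrete _).preimage hf)
      have hV' := h.isOpenMap _ hV
      filter_upwards [hV'.mem_nhds ⟨y, ⟨hy, rfl⟩, rfl⟩]
      rintro _ ⟨z, ⟨hz, hz'⟩, rfl⟩
      rw [hval z hz, hval y hy]
      exact hz'
    · have hcl : IsClosed (σ '' P i) :=
        ((hP i).isClosed.isCompact.image h.continuous).isClosed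
      have hzero : ∀ z, z ∉ σ '' P i → ∑ᶠ w ∈ P i ∩ σ ⁻¹' {z}, f w = 0 := by
        intro z hz
        have : P i ∩ σ ⁻¹' {z} = ∅ := by
          ext w
          simp only [mem_inter_iff, mem_preimage, mem_singleton_iff, mem_empty_iff_false,
            iff_false, not_and]
          intro hw hw'
          exact hz ⟨w, hw, hw'⟩
        rw [this, finsum_mem_empty]
      filter_upwards [hcl.isOpen_compl.mem_nhds hx] with z hz
      rw [hzero z hz, hzero x hx]
  exact hloc.continuous

variable [CompactSpace X] [T2Space X]

/-- The transfer map as an endomorphism of the group `C(X, ℤ)`. -/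
noncomputable def transferHom (σ : X → X) (h : IsPiecewiseHomeo σ) : C(X, ℤ) →+ C(X, ℤ) :=
  AddMonoidHom.mk' (fun f => ⟨transfer σ f, h.continuous_transfer f.continuous⟩) (by
    intro f g
    ext x
    exact congrFun (h.transfer_add f g) x)

theorem transferHom_surjective (σ : X → X) (h : IsPiecewiseHomeo σ)
    (hs : Function.Surjective σ) : Function.Surjective (transferHom σ h) := by
  classical
  intro f
  obtain ⟨n, P, hP, hdisj, hU, hinj⟩ := h.exists_partition
  have hQ : ∀ i, IsClopen (σ '' P i) := fun i =>
    ⟨((hP i).isClosed.isCompact.image h.continuous).isClosed, h.isOpenMap _ (hP i).isOpen⟩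
  -- a clopen set which `σ` maps bijectively onto `X`
  let E : Set X := ⋃ i, (P i ∩ ⋂ j, ⋂ _ : j < i, (σ ⁻¹' (σ '' P j))ᶜ)
  have hE : IsClopen E := by
    refine isClopen_iUnion_of_finite fun i => (hP i).inter ?_
    refine isClopen_iInter_of_finite fun j => isClopen_iInter_of_finite fun _ => ?_
    exact ((hQ j).preimage h.continuous).compl
  have hfib : ∀ x, ∃ y, E ∩ σ ⁻¹' {x} = {y} ∧ σ y = x := by
    intro x
    have hex : ∃ i, x ∈ σ '' P i := by
      obtain ⟨y, rfl⟩ := hs x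
      have : y ∈ ⋃ i, P i := by rw [hU]; trivial
      obtain ⟨i, hi⟩ := mem_iUnion.1 this
      exact ⟨i, y, hi, rfl⟩
    obtain ⟨i, hi, hmin⟩ := WellFounded.has_min (wellFounded_lt (α := Fin n))
      {i | x ∈ σ '' P i} hex
    obtain ⟨y, hy, hyx⟩ := hi
    refine ⟨y, ?_, hyx⟩
    ext z
    constructor
    · rintro ⟨hz, hzx⟩
      have hzx : σ z = x := hzx
      obtain ⟨k, hk, hk'⟩ := mem_iUnion.1 hz
      simp only [mem_iInter, mem_compl_iff, mem_preimage] at hk'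
      have h1 : ¬ k < i := hmin k ⟨z, hk, hzx⟩
      have h2 : ¬ i < k := fun hik => hk' i hik ⟨y, hy, by rw [hyx, hzx]⟩
      obtain rfl : k = i := le_antisymm (not_lt.1 h2) (not_lt.1 h1)
      exact hinj k hk hy (hzx.trans hyx.symm)
    · rintro rfl
      refine ⟨mem_iUnion.2 ⟨i, hy, ?_⟩, hyx⟩
      simp only [mem_iInter, mem_compl_iff, mem_preimage]
      intro j hj hj'
      rw [hyx] at hj'
      exact hmin j hj' hj
  refine ⟨⟨E.indicator (fun y => f (σ y)), ?_⟩, ?_⟩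
  · exact (f.continuous.comp h.continuous).indicator (by simp [hE.frontier_eq])
  · ext x
    obtain ⟨y, hy, hyx⟩ := hfib x
    change ∑ᶠ z ∈ σ ⁻¹' {x}, E.indicator (fun w => f (σ w)) z = f x
    have : ∀ z, (∑ᶠ _ : z ∈ σ ⁻¹' {x}, E.indicator (fun w => f (σ w)) z)
        = ∑ᶠ _ : z ∈ E ∩ σ ⁻¹' {x}, f (σ z) := by
      intro z
      by_cases h1 : z ∈ σ ⁻¹' {x} <;> by_cases h2 : z ∈ E <;> simp [h1, h2]
    rw [finsum_congr this, hy, finsum_mem_singleton, hyx]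

/-- The functions `f` with `L ^ n f = 0` for some `n`. -/
def eventualKer (σ : X → X) (h : IsPiecewiseHomeo σ) : AddSubgroup C(X, ℤ) where
  carrier := {f | ∃ n : ℕ, (transferHom σ h)^[n] f = 0}
  zero_mem' := ⟨0, rfl⟩
  add_mem' := by
    rintro f g ⟨n, hn⟩ ⟨m, hm⟩
    refine ⟨n + m, ?_⟩
    rw [iterate_map_add, add_comm n m, Function.iterate_add_apply, hn, iterate_map_zero,
      add_comm m n, Function.iterate_add_apply, hm, iterate_map_zero, add_zero]
  neg_mem' := by
    rintro f ⟨n, hn⟩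
    exact ⟨n, by rw [iterate_map_neg, hn, neg_zero]⟩

/-- The dimension group `G_σ`: the quotient of `C(X, ℤ)` by the relation
`f ∼ g ↔ ∃ n, L ^ n f = L ^ n g`. -/
abbrev DimGroup (σ : X → X) (h : IsPiecewiseHomeo σ) : Type _ := C(X, ℤ) ⧸ eventualKer σ h

theorem dimGroup_mk_eq_iff (σ : X → X) (h : IsPiecewiseHomeo σ) (f g : C(X, ℤ)) :
    ((f : DimGroup σ h) = g) ↔ ∃ n : ℕ, (transferHom σ h)^[n] f = (transferHom σ h)^[n] g := by
  rw [QuotientAddGroup.eq_iff_sub_mem]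
  refine exists_congr fun n => ?_
  rw [iterate_map_sub, sub_eq_zero]

/-- The positive cone `G_σ⁺ = {[f] | f ≥ 0}`. -/
def DimGroup.posCone (σ : X → X) (h : IsPiecewiseHomeo σ) : Set (DimGroup σ h) :=
  {x | ∃ f : C(X, ℤ), 0 ≤ f ∧ (f : DimGroup σ h) = x}

/-- The endomorphism `L_* [f] = [L f]` of `G_σ`. -/
noncomputable def DimGroup.star (σ : X → X) (h : IsPiecewiseHomeo σ) :
    DimGroup σ h →+ DimGroup σ h :=
  QuotientAddGroup.map _ _ (transferHom σ h) (by
    rintro f ⟨n, hn⟩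
    refine ⟨n, ?_⟩
    rw [← Function.iterate_succ_apply, Function.iterate_succ_apply', hn, map_zero])

theorem DimGroup.star_bijective (σ : X → X) (h : IsPiecewiseHomeo σ)
    (hs : Function.Surjective σ) : Function.Bijective (DimGroup.star σ h) := by
  constructor
  · rw [injective_iff_map_eq_zero]
    intro x
    induction x using QuotientAddGroup.induction_on with
    | H f =>
      intro hf
      have hf' : ((transferHom σ h f : C(X, ℤ)) : DimGroup σ h) = 0 := hf
      rw [QuotientAddGroup.eq_zero_iff] at hf' ⊢
      obtain ⟨n, hn⟩ := hf'
      exact ⟨n + 1, hn⟩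
  · intro x
    induction x using QuotientAddGroup.induction_on with
    | H f =>
      obtain ⟨g, rfl⟩ := transferHom_surjective σ h hs f
      exact ⟨(g : DimGroup σ h), rfl⟩

/-- For surjective `σ`, the automorphism `L_*` of `G_σ`. -/
noncomputable def DimGroup.starAut (σ : X → X) (h : IsPiecewiseHomeo σ)
    (hs : Function.Surjective σ) : DimGroup σ h ≃+ DimGroup σ h :=
  AddEquiv.ofBijective (DimGroup.star σ h) (DimGroup.star_bijective σ h hs)

end Transfer

/-! ## The module over Laurent polynomials given by an automorphism -/

section Laurent

variable {G : Type*} [AddCommGroup G]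

/-- An automorphism of an abelian group as a unit of its endomorphism ring. -/
def autUnit (e : G ≃+ G) : (AddMonoid.End G)ˣ where
  val := e.toAddMonoidHom
  inv := e.symm.toAddMonoidHom
  val_inv := by ext x; exact e.apply_symm_apply x
  inv_val := by ext x; exact e.symm_apply_apply x

/-- An automorphism `e` of an abelian group `G` makes `G` a module over `ℤ[T;T⁻¹]`, with
`(∑ zᵢ Tⁱ) • x = ∑ zᵢ eⁱ(x)`. -/
noncomputable abbrev laurentModule (e : G ≃+ G) : Module ℤ[T;T⁻¹] G :=
  Module.compHom G (AddMonoidAlgebra.lift ℤ (AddMonoid.End G) ℤ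
    ((Units.coeHom (AddMonoid.End G)).comp (zpowersHom _ (autUnit e)))).toRingHom

theorem laurentModule_C_mul_T_smul (e : G ≃+ G) (z n : ℤ) (x : G) :
    letI := laurentModule e
    (LaurentPolynomial.C z * LaurentPolynomial.T n : ℤ[T;T⁻¹]) • x
      = z • (((autUnit e ^ n : (AddMonoid.End G)ˣ) : AddMonoid.End G) x) := by
  change (AddMonoidAlgebra.lift ℤ (AddMonoid.End G) ℤ
    ((Units.coeHom (AddMonoid.End G)).comp (zpowersHom _ (autUnit e))))
    (LaurentPolynomial.C z * LaurentPolynomial.T n : ℤ[T;T⁻¹]) x = _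
  rw [← LaurentPolynomial.single_eq_C_mul_T, AddMonoidAlgebra.lift_single]
  rfl

end Laurent

/-! ## Disconnecting the unit interval -/

/-- The unit interval with each point `x` of `S`, other than `0` and `1`, replaced by two points
`x⁻ < x⁺`. A point consists of a point of the interval (its image under the collapse map `proj`)
and a side, `false` for `-` and `true` for `+`. The point `0` is represented by `0⁺`, the point `1`
by `1⁻`, and a point `x` outside `S ∪ {0, 1}`, for which `x⁻ = x⁺`, by `x⁻`. -/
structure Disc (S : Set unitInterval) where
  proj : unitInterval
  side : Bool
  side_true : side = true → proj = 0 ∨ (proj ∈ S ∧ proj ≠ 1)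
  side_false : side = false → proj ≠ 0

namespace Disc

variable {S : Set unitInterval}

theorem ext' {p q : Disc S} (h1 : p.proj = q.proj) (h2 : p.side = q.side) : p = q := by
  cases p; cases q; cases h1; cases h2; rfl

/-- The lexicographic order. -/
noncomputable instance : LinearOrder (Disc S) :=
  LinearOrder.lift' (fun p => (toLex (p.proj, p.side) : unitInterval ×ₗ Bool)) (by
    intro p q h
    have h' : (p.proj, p.side) = (q.proj, q.side) := toLex.injective h
    exact ext' (congrArg Prod.fst h') (congrArg Prod.snd h'))

/-- The order topology. -/
noncomputable instance : TopologicalSpace (Disc S) := Preorder.topology _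

instance : OrderTopology (Disc S) := ⟨rfl⟩

/-- The smallest point `x⁻` over `x`. -/
noncomputable def lower (S : Set unitInterval) (x : unitInterval) : Disc S :=
  if h : x = 0 then ⟨x, true, fun _ => Or.inl h, fun h' => by simp at h'⟩
  else ⟨x, false, fun h' => by simp at h', fun _ => h⟩

open Classical in
/-- The largest point `x⁺` over `x`. -/
noncomputable def upper (S : Set unitInterval) (x : unitInterval) : Disc S :=
  if h : x = 0 ∨ (x ∈ S ∧ x ≠ 1) then ⟨x, true, fun _ => h, fun h' => by simp at h'⟩
  else ⟨x, false, fun h' => by simp at h', fun _ h' => h (Or.inl h')⟩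

theorem lt_iff {p q : Disc S} :
    p < q ↔ p.proj < q.proj ∨ p.proj = q.proj ∧ p.side = false ∧ q.side = true := by
  have : p < q ↔ (toLex (p.proj, p.side) : unitInterval ×ₗ Bool) < toLex (q.proj, q.side) :=
    Iff.rfl
  rw [this, Prod.Lex.toLex_lt_toLex, Bool.lt_iff]

@[simp] theorem proj_lower (x : unitInterval) : (lower S x).proj = x := by
  by_cases h : x = 0
  · rw [lower, dif_pos h]
  · rw [lower, dif_neg h]

@[simp] theorem proj_upper (x : unitInterval) : (upper S x).proj = x := by
  by_cases h : x = 0 ∨ (x ∈ S ∧ x ≠ 1)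
  · rw [upper, dif_pos h]
  · rw [upper, dif_neg h]

theorem side_lower_zero : (lower S 0).side = true := by simp [lower]

theorem side_lower {x : unitInterval} (h : x ≠ 0) : (lower S x).side = false := by
  simp [lower, h]

theorem side_upper {x : unitInterval} (h : x = 0 ∨ (x ∈ S ∧ x ≠ 1)) :
    (upper S x).side = true := by
  rw [upper, dif_pos h]

theorem side_upper_not {x : unitInterval} (h : ¬ (x = 0 ∨ (x ∈ S ∧ x ≠ 1))) :
    (upper S x).side = false := by
  rw [upper, dif_neg h]

theorem proj_mono : Monotone (proj : Disc S → unitInterval) := by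
  intro p q h
  rcases h.lt_or_eq with h | rfl
  · rcases lt_iff.1 h with h | h
    · exact h.le
    · exact h.1.le
  · exact le_rfl

theorem lower_le {p : Disc S} {x : unitInterval} (h : p.proj = x) : lower S x ≤ p := by
  by_contra! hlt
  rcases lt_iff.1 hlt with h' | ⟨-, h1, h2⟩
  · rw [h, proj_lower] at h'; exact lt_irrefl _ h'
  · by_cases hx : x = 0
    · exact p.side_false h1 (h.trans hx)
    · rw [side_lower hx] at h2; simp at h2

theorem le_upper {p : Disc S} {x : unitInterval} (h : p.proj = x) : p ≤ upper S x := by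
  by_contra! hlt
  rcases lt_iff.1 hlt with h' | ⟨-, h1, h2⟩
  · rw [h, proj_upper] at h'; exact lt_irrefl _ h'
  · have := p.side_true h2
    rw [h] at this
    rw [side_upper this] at h1; simp at h1

theorem eq_lower_or_upper (p : Disc S) : p = lower S p.proj ∨ p = upper S p.proj := by
  cases hs : p.side
  · exact Or.inl (ext' (by simp) (by rw [hs, side_lower (p.side_false hs)]))
  · exact Or.inr (ext' (by simp) (by rw [hs, side_upper (p.side_true hs)]))

theorem lt_lower_iff {p : Disc S} {x : unitInterval} : p < lower S x ↔ p.proj < x := by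
  constructor
  · intro h
    rcases (proj_mono h.le).lt_or_eq with h' | h'
    · simpa using h'
    · exact absurd (lower_le (by simpa using h')) (not_le.2 h)
  · intro h
    exact lt_iff.2 (Or.inl (by simpa using h))

theorem upper_lt_iff {p : Disc S} {x : unitInterval} : upper S x < p ↔ x < p.proj := by
  constructor
  · intro h
    rcases (proj_mono h.le).lt_or_eq with h' | h'
    · simpa using h'
    · exact absurd (le_upper (by simpa using h'.symm)) (not_le.2 h)
  · intro h
    exact lt_iff.2 (Or.inl (by simpa using h))

theorem lower_lt_upper {x : unitInterval} (hx : x ∈ S) (h0 : x ≠ 0) (h1 : x ≠ 1) :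
    lower S x < upper S x :=
  lt_iff.2 (Or.inr ⟨by simp, side_lower h0, side_upper (Or.inr ⟨hx, h1⟩)⟩)

theorem lower_le_upper (x : unitInterval) : lower S x ≤ upper S x := lower_le (by simp)

theorem lower_zero_le (p : Disc S) : lower S 0 ≤ p := by
  by_contra! h
  exact not_lt_bot (α := unitInterval) (lt_lower_iff.1 h)

theorem upper_zero_eq : upper S 0 = lower S 0 :=
  ext' (by simp) (by rw [side_upper (Or.inl rfl), side_lower_zero])

theorem lower_one_eq : lower S 1 = upper S 1 :=
  ext' (by simp) (by rw [side_lower one_ne_zero, side_upper_not (by simp)])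

theorem le_lower_one (p : Disc S) : p ≤ lower S 1 := by
  by_contra! h
  rw [lower_one_eq] at h
  exact not_top_lt (α := unitInterval) (upper_lt_iff.1 h)

/-- For a point of `S`, nothing lies strictly between `x⁻` and `x⁺`. -/
theorem upper_le_iff {x : unitInterval} (hx : x ∈ S) (h0 : x ≠ 0) (h1 : x ≠ 1) {p : Disc S} :
    upper S x ≤ p ↔ lower S x < p := by
  refine ⟨fun h => (lower_lt_upper hx h0 h1).trans_le h, fun h => ?_⟩
  rcases lt_iff.1 h with h | ⟨h, -, h'⟩
  · exact (upper_lt_iff.2 (by simpa using h)).le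
  · refine (ext' (by simpa using h) ?_).le
    rw [h', side_upper (Or.inr ⟨hx, h1⟩)]

theorem isOpen_Ici_upper {x : unitInterval} (hx : x ∈ S) (h1 : x ≠ 1) :
    IsOpen (Ici (upper S x)) := by
  by_cases h0 : x = 0
  · subst h0
    have : Ici (upper S 0) = univ := by
      ext p; simpa [upper_zero_eq] using lower_zero_le p
    rw [this]; exact isOpen_univ
  · have : Ici (upper S x) = Ioi (lower S x) := by
      ext p; exact upper_le_iff hx h0 h1
    rw [this]; exact isOpen_Ioi

theorem isOpen_Iic_lower {x : unitInterval} (hx : x ∈ S) (h0 : x ≠ 0) :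
    IsOpen (Iic (lower S x)) := by
  by_cases h1 : x = 1
  · subst h1
    have : Iic (lower S 1) = univ := by
      ext p; simpa using le_lower_one p
    rw [this]; exact isOpen_univ
  · have : Iic (lower S x) = Iio (upper S x) := by
      ext p
      rw [mem_Iic, mem_Iio, ← not_lt, ← not_le (a := upper S x), upper_le_iff hx h0 h1]
    rw [this]; exact isOpen_Iio

/-- The order interval `[a⁺, b⁻]` is clopen for `a < b` in `S`. -/
theorem isClopen_Icc {a b : unitInterval} (ha : a ∈ S) (hb : b ∈ S) (hab : a < b) :
    IsClopen (Icc (upper S a) (lower S b)) := by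
  refine ⟨isClosed_Icc, ?_⟩
  rw [← Ici_inter_Iic]
  exact (isOpen_Ici_upper ha (hab.trans_le le_top).ne).inter
    (isOpen_Iic_lower hb (bot_le.trans_lt hab).ne')

instance : CompactSpace (Disc S) := by
  refine ⟨isCompact_iff_ultrafilter_le_nhds.2 fun U _ => ?_⟩
  have aux : ∀ a : Disc S, (∀ b, b < a → ∀ᶠ p in (U : Filter (Disc S)), b < p) →
      (∀ b, a < b → ∀ᶠ p in (U : Filter (Disc S)), p < b) → ∃ x ∈ univ, (U : Filter (Disc S)) ≤ nhds x := by
    intro a h1 h2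
    exact ⟨a, trivial, (tendsto_order.2 ⟨h1, h2⟩ : Tendsto id (U : Filter (Disc S)) _)⟩
  obtain ⟨x, -, hx⟩ := isCompact_iff_ultrafilter_le_nhds.1 (isCompact_univ (X := unitInterval))
    (U.map proj) (by simp)
  have hx' : Tendsto proj (U : Filter (Disc S)) (nhds x) := hx
  have hlt := (tendsto_order.1 hx').1
  have hgt := (tendsto_order.1 hx').2
  have h3 : ∀ᶠ p in (U : Filter (Disc S)), p < lower S x ∨ (p = lower S x ∨ p = upper S x) ∨
      upper S x < p := Eventually.of_forall fun p => by
    rcases lt_trichotomy p.proj x with h | h | h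
    · exact Or.inl (lt_lower_iff.2 h)
    · have := eq_lower_or_upper p
      rw [h] at this
      exact Or.inr (Or.inl this)
    · exact Or.inr (Or.inr (upper_lt_iff.2 h))
  rw [Ultrafilter.eventually_or, Ultrafilter.eventually_or, Ultrafilter.eventually_or] at h3
  have pt : ∀ a : Disc S, (∀ᶠ p in (U : Filter (Disc S)), p = a) →
      ∃ x ∈ univ, (U : Filter (Disc S)) ≤ nhds x := by
    intro a h
    refine aux a (fun b hb => ?_) (fun b hb => ?_)
    · filter_upwards [h] with p hp; rwa [hp]
    · filter_upwards [h] with p hp; rwa [hp]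
  rcases h3 with h | (h | h) | h
  · refine aux (lower S x) (fun b hb => ?_) (fun b hb => ?_)
    · filter_upwards [hlt _ (lt_lower_iff.1 hb)] with p hp
      exact lt_iff.2 (Or.inl hp)
    · filter_upwards [h] with p hp
      exact hp.trans hb
  · exact pt _ h
  · exact pt _ h
  · refine aux (upper S x) (fun b hb => ?_) (fun b hb => ?_)
    · filter_upwards [h] with p hp
      exact hb.trans hp
    · filter_upwards [hgt _ (upper_lt_iff.1 hb)] with p hp
      exact lt_iff.2 (Or.inl hp)

end Disc

/-! ## Unimodal maps and the associated local homeomorphism -/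

/-- A unimodal map with critical point `c`: a continuous map of the unit interval which increases
strictly on `[0, c]` and decreases strictly on `[c, 1]`, where `0 < c < 1`. -/
structure IsUnimodal (τ : unitInterval → unitInterval) (c : unitInterval) : Prop where
  pos : 0 < c
  lt_one : c < 1
  continuous : Continuous τ
  strictMonoOn : StrictMonoOn τ (Icc 0 c)
  strictAntiOn : StrictAntiOn τ (Icc c 1)

/-- The maximal partition associated with a unimodal map with critical point `c`. -/
def partitionPts (c : unitInterval) : Set unitInterval := {0, c, 1}

/-- The generalized orbit `I₁` of the partition `{0, c, 1}`: the smallest set which contains it and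
is closed under `τ` and `τ⁻¹`. -/
def genOrbit (τ : unitInterval → unitInterval) (c : unitInterval) : Set unitInterval :=
  ⋂₀ {S | partitionPts c ⊆ S ∧ τ '' S ⊆ S ∧ τ ⁻¹' S ⊆ S}

section GenOrbit

variable {τ : unitInterval → unitInterval} {c : unitInterval}

theorem partitionPts_subset : partitionPts c ⊆ genOrbit τ c :=
  fun _ hx _ hS => hS.1 hx

theorem zero_mem_genOrbit : 0 ∈ genOrbit τ c := partitionPts_subset (by simp [partitionPts])

theorem one_mem_genOrbit : 1 ∈ genOrbit τ c := partitionPts_subset (by simp [partitionPts])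

theorem crit_mem_genOrbit : c ∈ genOrbit τ c := partitionPts_subset (by simp [partitionPts])

theorem map_mem_genOrbit_iff {x : unitInterval} : τ x ∈ genOrbit τ c ↔ x ∈ genOrbit τ c :=
  ⟨fun h S hS => hS.2.2 (h S hS), fun h S hS => hS.2.1 ⟨x, h S hS, rfl⟩⟩

end GenOrbit

/-- The space `X`: the disconnection of the unit interval at the points of the generalized orbit. -/
abbrev DiscSpace (τ : unitInterval → unitInterval) (c : unitInterval) : Type :=
  Disc (genOrbit τ c)

/-- The point `x⁺` (for `true`) or `x⁻` (for `false`). -/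
noncomputable def Disc.signed (S : Set unitInterval) (x : unitInterval) : Bool → Disc S
  | true => Disc.upper S x
  | false => Disc.lower S x

/-- The map `σ : X → X` associated with a unimodal map: `σ(x^±) = τ(x)^±` on `[0⁺, c⁻]`, where `τ`
increases, and `σ(x^±) = τ(x)^∓` on `[c⁺, 1⁻]`, where `τ` decreases. -/
noncomputable def sigma (τ : unitInterval → unitInterval) (c : unitInterval)
    (p : DiscSpace τ c) : DiscSpace τ c :=
  if p ≤ Disc.lower _ c then Disc.signed _ (τ p.proj) p.side
  else Disc.signed _ (τ p.proj) (!p.side)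

theorem proj_sigma (τ : unitInterval → unitInterval) (c : unitInterval) (p : DiscSpace τ c) :
    (sigma τ c p).proj = τ p.proj := by
  unfold sigma
  split_ifs <;> cases p.side <;> simp [Disc.signed]

theorem piece_aux {X : Type*} [LinearOrder X] [TopologicalSpace X] [OrderTopology X]
    [CompactSpace X] {σ : X → X} {P Q : Set X} (hP : IsClosed P) (hPo : P.OrdConnected)
    (hQ : IsOpen Q) (hQo : Q.OrdConnected) (himg : σ '' P = Q)
    (hinj : InjOn σ P) (hm : StrictMonoOn σ P ∨ StrictAntiOn σ P) :
    ContinuousOn σ P ∧ ∀ U, IsOpen U → IsOpen (σ '' (U ∩ P)) := by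
  have hmaps : MapsTo σ P Q := fun x hx => himg ▸ mem_image_of_mem σ hx
  have hsurj : Function.Surjective (hmaps.restrict σ P Q) := by
    rintro ⟨q, hq⟩
    obtain ⟨x, hx, hxq⟩ := himg.symm ▸ hq
    exact ⟨⟨x, hx⟩, Subtype.ext hxq⟩
  have hcont : ContinuousOn σ P := by
    rw [continuousOn_iff_continuous_domRestrict]
    have : Continuous (hmaps.restrict σ P Q) := by
      have : P.OrdConnected := hPo
      have : Q.OrdConnected := hQo
      rcases hm with hm | hm
      · have hm' : StrictMono (hmaps.restrict σ P Q) := fun a b hab => hm a.2 b.2 hab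
        exact (hm'.orderIsoOfSurjective _ hsurj).continuous
      · have hm' : StrictMono (fun x => OrderDual.toDual (hmaps.restrict σ P Q x)) :=
          fun a b hab => hm a.2 b.2 hab
        have : Continuous (fun x => OrderDual.toDual (hmaps.restrict σ P Q x)) :=
          (hm'.orderIsoOfSurjective _ hsurj).continuous
        exact this
    exact continuous_subtype_val.comp this
  refine ⟨hcont, fun U hU => ?_⟩
  have : σ '' (U ∩ P) = Q ∩ (σ '' (Uᶜ ∩ P))ᶜ := by
    ext y
    constructor
    · rintro ⟨x, ⟨hxU, hxP⟩, rfl⟩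
      refine ⟨hmaps hxP, ?_⟩
      rintro ⟨z, ⟨hzU, hzP⟩, hz⟩
      exact hzU (hinj hzP hxP hz ▸ hxU)
    · rintro ⟨hy, hy'⟩
      rw [← himg] at hy
      obtain ⟨x, hx, rfl⟩ := hy
      refine ⟨x, ⟨?_, hx⟩, rfl⟩
      by_contra hxU
      exact hy' ⟨x, ⟨hxU, hx⟩, rfl⟩
  rw [this]
  refine hQ.inter (IsClosed.isOpen_compl (self := ?_))
  exact ((hU.isClosed_compl.inter hP).isCompact.image_of_continuousOn
    (hcont.mono inter_subset_right)).isClosed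

section Unimodal

variable {τ : unitInterval → unitInterval} {c : unitInterval}

theorem IsUnimodal.lt_max_left (h : IsUnimodal τ c) {x : unitInterval} (hx : x < c) : τ x < τ c :=
  h.strictMonoOn ⟨bot_le, hx.le⟩ ⟨bot_le, le_rfl⟩ hx

theorem IsUnimodal.lt_max_right (h : IsUnimodal τ c) {x : unitInterval} (hx : c < x) : τ x < τ c :=
  h.strictAntiOn ⟨le_rfl, le_top⟩ ⟨hx.le, le_top⟩ hx

theorem IsUnimodal.strictMono_sigma (h : IsUnimodal τ c) :
    StrictMonoOn (sigma τ c) (Iic (Disc.lower _ c)) := by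
  intro p hp q hq hpq
  have hp' : p.proj ≤ c := by simpa using Disc.proj_mono hp
  have hq' : q.proj ≤ c := by simpa using Disc.proj_mono hq
  rcases Disc.lt_iff.1 hpq with h1 | ⟨h1, h2, h3⟩
  · refine Disc.lt_iff.2 (Or.inl ?_)
    rw [proj_sigma, proj_sigma]
    exact h.strictMonoOn ⟨bot_le, hp'⟩ ⟨bot_le, hq'⟩ h1
  · have hp0 : 0 < p.proj := bot_lt_iff_ne_bot.2 (p.side_false h2)
    have hS : q.proj ∈ genOrbit τ c :=
      ((q.side_true h3).resolve_left (h1 ▸ hp0.ne')).1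
    have hqc : q.proj < c := by
      rw [← h1, ← Disc.lt_lower_iff (S := genOrbit τ c)]
      exact hpq.trans_le hq
    unfold sigma
    rw [if_pos (show p ≤ _ from hp), if_pos (show q ≤ _ from hq), h2, h3, h1]
    refine Disc.lower_lt_upper (map_mem_genOrbit_iff.2 hS) ?_ ?_
    · exact (bot_le.trans_lt (h.strictMonoOn (a := 0) ⟨le_rfl, h.pos.le⟩ ⟨bot_le, hq'⟩
        (h1 ▸ hp0))).ne'
    · exact ((h.lt_max_left hqc).trans_le le_top).ne

theorem IsUnimodal.strictAnti_sigma (h : IsUnimodal τ c) :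
    StrictAntiOn (sigma τ c) (Ici (Disc.upper _ c)) := by
  intro p hp q hq hpq
  have hp' : c ≤ p.proj := by simpa using Disc.proj_mono hp
  have hq' : c ≤ q.proj := by simpa using Disc.proj_mono hq
  have hcl : Disc.lower (genOrbit τ c) c < Disc.upper _ c :=
    Disc.lower_lt_upper crit_mem_genOrbit h.pos.ne' h.lt_one.ne
  rcases Disc.lt_iff.1 hpq with h1 | ⟨h1, h2, h3⟩
  · refine Disc.lt_iff.2 (Or.inl ?_)
    rw [proj_sigma, proj_sigma]
    exact h.strictAntiOn ⟨hp', le_top⟩ ⟨hq', le_top⟩ h1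
  · have hp0 : 0 < p.proj := bot_lt_iff_ne_bot.2 (p.side_false h2)
    have hS := (q.side_true h3).resolve_left (h1 ▸ hp0.ne')
    have hcq : c < q.proj := by
      rw [← Disc.upper_lt_iff (S := genOrbit τ c)]
      exact lt_of_le_of_lt hp hpq
    unfold sigma
    rw [if_neg (not_le.2 (hcl.trans_le hp)), if_neg (not_le.2 (hcl.trans_le hq)), h2, h3, h1]
    refine Disc.lower_lt_upper (map_mem_genOrbit_iff.2 hS.1) ?_ ?_
    · exact (bot_le.trans_lt (h.strictAntiOn (b := 1) ⟨hq', le_top⟩ ⟨h.lt_one.le, le_rfl⟩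
        (lt_of_le_of_ne le_top hS.2))).ne'
    · exact ((h.lt_max_right hcq).trans_le le_top).ne

theorem IsUnimodal.image_left (h : IsUnimodal τ c) :
    sigma τ c '' Iic (Disc.lower _ c) = Icc (Disc.upper _ (τ 0)) (Disc.lower _ (τ c)) := by
  have h0c := h.lt_max_left h.pos
  apply Subset.antisymm
  · rintro _ ⟨p, hp, rfl⟩
    have e1 : sigma τ c (Disc.lower _ 0) = Disc.upper _ (τ 0) := by
      unfold sigma
      rw [if_pos (Disc.lower_zero_le _), Disc.side_lower_zero]; simp [Disc.signed]
    have e2 : sigma τ c (Disc.lower _ c) = Disc.lower _ (τ c) := by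
      unfold sigma
      rw [if_pos le_rfl, Disc.side_lower h.pos.ne']; simp [Disc.signed]
    rw [← e1, ← e2]
    exact ⟨h.strictMono_sigma.monotoneOn (Disc.lower_zero_le _) hp (Disc.lower_zero_le _),
      h.strictMono_sigma.monotoneOn hp (mem_Iic.2 le_rfl) hp⟩
  · rintro q ⟨hq1, hq2⟩
    have hy1 : τ 0 ≤ q.proj := by simpa using Disc.proj_mono hq1
    have hy2 : q.proj ≤ τ c := by simpa using Disc.proj_mono hq2
    obtain ⟨x, hx, hxq⟩ := intermediate_value_Icc h.pos.le h.continuous.continuousOn ⟨hy1, hy2⟩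
    have hτ0 : Disc.lower (genOrbit τ c) (τ 0) < Disc.upper _ (τ 0) ∨ τ 0 = 0 := by
      by_cases h0 : τ 0 = 0
      · exact Or.inr h0
      · exact Or.inl (Disc.lower_lt_upper (map_mem_genOrbit_iff.2 zero_mem_genOrbit) h0
          (h0c.trans_le le_top).ne)
    let p : DiscSpace τ c := ⟨x, q.side, by
      intro hs
      rcases q.side_true hs with h1 | h1
      · left
        by_contra hx0
        have : τ 0 < τ x := h.strictMonoOn ⟨le_rfl, h.pos.le⟩ hx (bot_lt_iff_ne_bot.2 hx0)
        rw [hxq, h1] at this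
        exact not_lt_bot this
      · right
        rw [← hxq] at h1
        exact ⟨map_mem_genOrbit_iff.1 h1.1, (hx.2.trans_lt h.lt_one).ne⟩, by
      intro hs hx0
      rw [hx0] at hxq
      rcases hτ0 with h1 | h1
      · have : q = Disc.lower _ (τ 0) := by
          refine Disc.ext' (by simp [hxq]) ?_
          rw [hs, Disc.side_lower]
          rw [hxq]; exact q.side_false hs
        rw [this] at hq1
        exact absurd h1 (not_lt.2 hq1)
      · exact q.side_false hs (hxq.symm.trans h1)⟩
    have hp : p ≤ Disc.lower _ c := by
      by_contra! hlt
      rcases Disc.lt_iff.1 hlt with h1 | ⟨h1, -, h2⟩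
      · rw [Disc.proj_lower] at h1
        exact not_lt.2 hx.2 h1
      · have hxc : x = c := by simpa [p] using h1.symm
        rw [hxc] at hxq
        have : Disc.lower _ (τ c) < q := by
          refine Disc.lt_iff.2 (Or.inr ⟨by simp [hxq], Disc.side_lower ?_, h2⟩)
          exact (bot_le.trans_lt h0c).ne'
        exact not_lt.2 hq2 this
    refine ⟨p, hp, ?_⟩
    unfold sigma
    rw [if_pos hp]
    change Disc.signed _ (τ x) q.side = q
    rw [hxq]
    refine Disc.ext' ?_ ?_
    · cases q.side <;> simp [Disc.signed]
    · cases hs : q.side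
      · exact Disc.side_lower (q.side_false hs)
      · exact Disc.side_upper (q.side_true hs)

theorem IsUnimodal.image_right (h : IsUnimodal τ c) :
    sigma τ c '' Ici (Disc.upper _ c) = Icc (Disc.upper _ (τ 1)) (Disc.lower _ (τ c)) := by
  have h1c := h.lt_max_right h.lt_one
  have hcl : Disc.lower (genOrbit τ c) c < Disc.upper _ c :=
    Disc.lower_lt_upper crit_mem_genOrbit h.pos.ne' h.lt_one.ne
  apply Subset.antisymm
  · rintro _ ⟨p, hp, rfl⟩
    have e1 : sigma τ c (Disc.lower _ 1) = Disc.upper _ (τ 1) := by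
      unfold sigma
      rw [if_neg (not_le.2 (Disc.lt_lower_iff.2 (by simpa using h.lt_one))),
        Disc.side_lower one_ne_zero]
      simp [Disc.signed]
    have e2 : sigma τ c (Disc.upper _ c) = Disc.lower _ (τ c) := by
      unfold sigma
      rw [if_neg (not_le.2 hcl),
        Disc.side_upper (Or.inr ⟨crit_mem_genOrbit, h.lt_one.ne⟩)]
      simp [Disc.signed]
    rw [← e1, ← e2]
    have h1 : Disc.lower (genOrbit τ c) 1 ∈ Ici (Disc.upper (genOrbit τ c) c) :=
      Disc.le_lower_one _
    exact ⟨h.strictAnti_sigma.antitoneOn hp h1 (Disc.le_lower_one _),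
      h.strictAnti_sigma.antitoneOn (mem_Ici.2 le_rfl) hp hp⟩
  · rintro q ⟨hq1, hq2⟩
    have hy1 : τ 1 ≤ q.proj := by simpa using Disc.proj_mono hq1
    have hy2 : q.proj ≤ τ c := by simpa using Disc.proj_mono hq2
    obtain ⟨x, hx, hxq⟩ := intermediate_value_Icc' h.lt_one.le h.continuous.continuousOn ⟨hy1, hy2⟩
    have hx0 : x ≠ 0 := (h.pos.trans_le hx.1).ne'
    have hneg : ∀ p : DiscSpace τ c, Disc.upper _ c ≤ p → sigma τ c p =
        Disc.signed _ (τ p.proj) (!p.side) := fun p hp =>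
      if_neg (not_le.2 (hcl.trans_le hp))
    cases hs : q.side
    · have hq0 := q.side_false hs
      have hp : Disc.upper _ c ≤ Disc.upper (genOrbit τ c) x := by
        rcases hx.1.lt_or_eq with h2 | h2
        · exact (Disc.upper_lt_iff.2 (by simpa using h2)).le
        · rw [h2]
      have hqe : q = Disc.lower _ (τ x) := by
        refine Disc.ext' (by simp [hxq]) ?_
        rw [hs, Disc.side_lower (hxq ▸ hq0)]
      refine ⟨Disc.upper _ x, hp, ?_⟩
      rw [hneg _ hp, Disc.proj_upper]
      by_cases hxS : x ∈ genOrbit τ c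
      · have hx1 : x ≠ 1 := by
          rintro rfl
          have h2 : Disc.lower (genOrbit τ c) (τ 1) < Disc.upper _ (τ 1) :=
            Disc.lower_lt_upper (map_mem_genOrbit_iff.2 one_mem_genOrbit) (hxq ▸ hq0)
              (h1c.trans_le le_top).ne
          rw [hqe] at hq1
          exact absurd h2 (not_lt.2 hq1)
        rw [Disc.side_upper (Or.inr ⟨hxS, hx1⟩), hqe]
        rfl
      · rw [Disc.side_upper_not (by tauto), hqe]
        change Disc.upper _ _ = _
        refine Disc.ext' (by simp) ?_
        have hyS : τ x ∉ genOrbit τ c := fun h' => hxS (map_mem_genOrbit_iff.1 h')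
        have hy0 : τ x ≠ 0 := hxq ▸ hq0
        rw [Disc.side_lower hy0, Disc.side_upper_not (by tauto)]
    · have hqe : q = Disc.upper _ (τ x) := by
        refine Disc.ext' (by simp [hxq]) ?_
        rw [hs, Disc.side_upper (hxq ▸ q.side_true hs)]
      have hxc : c < x := by
        refine lt_of_le_of_ne hx.1 ?_
        rintro rfl
        have : Disc.lower _ (τ c) < q :=
          Disc.lt_iff.2 (Or.inr ⟨by simp [hxq], Disc.side_lower (bot_le.trans_lt h1c).ne', hs⟩)
        exact not_lt.2 hq2 this
      have hp : Disc.upper _ c ≤ Disc.lower (genOrbit τ c) x :=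
        (Disc.upper_lt_iff.2 (by simpa using hxc)).le
      refine ⟨Disc.lower _ x, hp, ?_⟩
      rw [hneg _ hp, Disc.side_lower hx0, Disc.proj_lower, hqe]
      rfl

theorem IsUnimodal.isPiecewiseHomeo (h : IsUnimodal τ c) : IsPiecewiseHomeo (sigma τ c) := by
  have hcl : Disc.lower (genOrbit τ c) c < Disc.upper _ c :=
    Disc.lower_lt_upper crit_mem_genOrbit h.pos.ne' h.lt_one.ne
  have hU : Iic (Disc.lower (genOrbit τ c) c) ∪ Ici (Disc.upper (genOrbit τ c) c) = univ := by
    refine eq_univ_of_forall fun p => ?_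
    rcases le_or_gt p (Disc.lower _ c) with hp | hp
    · exact Or.inl hp
    · exact Or.inr ((Disc.upper_le_iff crit_mem_genOrbit h.pos.ne' h.lt_one.ne).2 hp)
  have hD : Disjoint (Iic (Disc.lower (genOrbit τ c) c)) (Ici (Disc.upper (genOrbit τ c) c)) := by
    rw [Set.disjoint_left]
    intro p hp hp'
    exact not_lt.2 (hp'.trans hp) hcl
  have hc1 : IsClopen (Iic (Disc.lower (genOrbit τ c) c)) :=
    ⟨isClosed_Iic, Disc.isOpen_Iic_lower crit_mem_genOrbit h.pos.ne'⟩
  have hc2 : IsClopen (Ici (Disc.upper (genOrbit τ c) c)) :=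
    ⟨isClosed_Ici, Disc.isOpen_Ici_upper crit_mem_genOrbit h.lt_one.ne⟩
  have hτc : τ c ∈ genOrbit τ c := map_mem_genOrbit_iff.2 crit_mem_genOrbit
  obtain ⟨hC1, hO1⟩ := piece_aux hc1.isClosed ordConnected_Iic
    (Disc.isClopen_Icc (map_mem_genOrbit_iff.2 zero_mem_genOrbit) hτc (h.lt_max_left h.pos)).isOpen
    ordConnected_Icc h.image_left h.strictMono_sigma.injOn (Or.inl h.strictMono_sigma)
  obtain ⟨hC2, hO2⟩ := piece_aux hc2.isClosed ordConnected_Ici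
    (Disc.isClopen_Icc (map_mem_genOrbit_iff.2 one_mem_genOrbit) hτc
      (h.lt_max_right h.lt_one)).isOpen
    ordConnected_Icc h.image_right h.strictAnti_sigma.injOn (Or.inr h.strictAnti_sigma)
  refine ⟨?_, ?_, 2, ![Iic (Disc.lower _ c), Ici (Disc.upper _ c)], ?_, ?_, ?_, ?_⟩
  · rw [← continuousOn_univ, ← hU]
    exact hC1.union_of_isClosed hC2 hc1.isClosed hc2.isClosed
  · intro U hUo
    have : sigma τ c '' U = sigma τ c '' (U ∩ Iic (Disc.lower _ c)) ∪
        sigma τ c '' (U ∩ Ici (Disc.upper _ c)) := by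
      rw [← image_union, ← inter_union_distrib_left, hU, inter_univ]
    rw [this]
    exact (hO1 U hUo).union (hO2 U hUo)
  · intro i; fin_cases i
    · exact hc1
    · exact hc2
  · intro i j hij
    fin_cases i <;> fin_cases j
    · exact absurd rfl hij
    · exact hD
    · exact hD.symm
    · exact absurd rfl hij
  · rw [← hU]
    ext p
    simp [Fin.exists_fin_two]
  · intro i; fin_cases i
    · exact h.strictMono_sigma.injOn
    · exact h.strictAnti_sigma.injOn

theorem IsUnimodal.sigma_surjective (h : IsUnimodal τ c) (hs : Function.Surjective τ) :
    Function.Surjective (sigma τ c) := by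
  have hc1 : τ c = 1 := by
    obtain ⟨x, hx⟩ := hs 1
    refine le_antisymm le_top (hx ▸ ?_)
    rcases lt_trichotomy x c with h1 | rfl | h1
    · exact (h.lt_max_left h1).le
    · exact le_rfl
    · exact (h.lt_max_right h1).le
  obtain ⟨x, hx⟩ := hs 0
  have hend : τ 0 = 0 ∨ τ 1 = 0 := by
    rcases le_total x c with h1 | h1
    · left
      refine le_antisymm ?_ bot_le
      exact (h.strictMonoOn.monotoneOn ⟨le_rfl, h.pos.le⟩ ⟨bot_le, h1⟩ bot_le).trans_eq hx
    · right
      refine le_antisymm ?_ bot_le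
      exact (h.strictAntiOn.antitoneOn ⟨h1, le_top⟩ ⟨h.lt_one.le, le_rfl⟩ le_top).trans_eq hx
  have hfull : ∀ q : DiscSpace τ c, q ∈ Icc (Disc.upper _ 0) (Disc.lower _ 1) := fun q =>
    ⟨Disc.upper_zero_eq (S := genOrbit τ c) ▸ Disc.lower_zero_le q, Disc.le_lower_one q⟩
  intro q
  rcases hend with h0 | h0
  · have := h.image_left
    rw [h0, hc1] at this
    obtain ⟨p, -, hp⟩ := this ▸ hfull q
    exact ⟨p, hp⟩
  · have := h.image_right
    rw [h0, hc1] at this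
    obtain ⟨p, -, hp⟩ := this ▸ hfull q
    exact ⟨p, hp⟩

end Unimodal

/-! ## The dimension triple and the dimension module of a unimodal map -/

section DG

variable {τ : unitInterval → unitInterval} {c : unitInterval}

/-- The dimension group `DG(τ)`. -/
abbrev DG (h : IsUnimodal τ c) : Type := DimGroup (sigma τ c) h.isPiecewiseHomeo

/-- The positive cone `DG(τ)⁺`. -/
def DG.posCone (h : IsUnimodal τ c) : Set (DG h) :=
  DimGroup.posCone (sigma τ c) h.isPiecewiseHomeo

/-- The endomorphism `L_*` of `DG(τ)`. -/
noncomputable def DG.star (h : IsUnimodal τ c) : DG h →+ DG h :=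
  DimGroup.star (sigma τ c) h.isPiecewiseHomeo

/-- The dimension module: for surjective `τ` the map `L_*` is an automorphism, and `DG(τ)` is the
`ℤ[T;T⁻¹]`-module on which `T` acts as `L_*`. -/
noncomputable abbrev DG.module (h : IsUnimodal τ c) (hs : Function.Surjective τ) :
    Module ℤ[T;T⁻¹] (DG h) :=
  laurentModule (DimGroup.starAut (sigma τ c) h.isPiecewiseHomeo (h.sigma_surjective hs))

/-- The element `I(a, b)` of `DG(τ)`, for `a < b` in the generalized orbit: the class of the
characteristic function of the clopen order interval `[a⁺, b⁻]`. -/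
noncomputable def DG.interval (h : IsUnimodal τ c) (a b : unitInterval)
    (ha : a ∈ genOrbit τ c) (hb : b ∈ genOrbit τ c) (hab : a < b) : DG h :=
  QuotientAddGroup.mk
    ⟨(Icc (Disc.upper (genOrbit τ c) a) (Disc.lower (genOrbit τ c) b)).indicator (fun _ => 1),
      continuous_const.indicator (by simp [(Disc.isClopen_Icc ha hb hab).frontier_eq])⟩

end DG

/-! ## Markov partitions and incidence matrices -/

/-- `0 = b 0 < b 1 < ⋯ < b n = 1` is a Markov partition for `τ`: its points are in the generalized
orbit, `τ` is monotonic on each `(b i, b (i + 1))` and maps it onto a set whose closure is a union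
of intervals `[b j, b (j + 1)]`, and some `τ ^ k` maps `{0, c, 1}` into the partition. -/
structure IsMarkovPartition (τ : unitInterval → unitInterval) (c : unitInterval) {n : ℕ}
    (b : Fin (n + 1) → unitInterval) : Prop where
  strictMono : StrictMono b
  first : b 0 = 0
  last : b (Fin.last n) = 1
  mem_genOrbit : ∀ i, b i ∈ genOrbit τ c
  monotone : ∀ i : Fin n, MonotoneOn τ (Ioo (b i.castSucc) (b i.succ)) ∨
    AntitoneOn τ (Ioo (b i.castSucc) (b i.succ))
  closure_image : ∀ i : Fin n, ∃ J : Set (Fin n),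
    closure (τ '' Ioo (b i.castSucc) (b i.succ)) = ⋃ j ∈ J, Icc (b j.castSucc) (b j.succ)
  iterate_subset : ∃ k : ℕ, τ^[k] '' partitionPts c ⊆ range b

/-- `τ` is Markov: it has a Markov partition. -/
def IsMarkov (τ : unitInterval → unitInterval) (c : unitInterval) : Prop :=
  ∃ (n : ℕ) (b : Fin (n + 1) → unitInterval), IsMarkovPartition τ c b

/-- The sets `E i = [(b i)⁺, (b (i + 1))⁻]` in `X` given by a partition of the interval. -/
def markovPiece (τ : unitInterval → unitInterval) (c : unitInterval) {n : ℕ}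
    (b : Fin (n + 1) → unitInterval) (i : Fin n) : Set (DiscSpace τ c) :=
  Icc (Disc.upper _ (b i.castSucc)) (Disc.lower _ (b i.succ))

open Classical in
/-- The incidence matrix: `A i j = 1` if `σ (E i) ⊇ E j`, and `A i j = 0` otherwise. -/
noncomputable def incidenceMatrix (τ : unitInterval → unitInterval) (c : unitInterval) {n : ℕ}
    (b : Fin (n + 1) → unitInterval) : Matrix (Fin n) (Fin n) ℤ :=
  Matrix.of fun i j =>
    if markovPiece τ c b j ⊆ sigma τ c '' markovPiece τ c b i then 1 else 0

/-! ## Stationary inductive limits of ordered groups -/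

section Limit

variable {G : Type*} [AddCommGroup G]

/-- The sequences `g` with `T (g k) = g (k + 1)` for all large `k`. -/
def eventuallyCompatible (T : G →+ G) : AddSubgroup (ℕ → G) where
  carrier := {g | ∀ᶠ k in atTop, T (g k) = g (k + 1)}
  zero_mem' := Eventually.of_forall fun _ => map_zero T
  add_mem' := by
    intro f g hf hg
    filter_upwards [hf, hg] with k h1 h2
    simp [h1, h2]
  neg_mem' := by
    intro f hf
    filter_upwards [hf] with k h1
    simp [h1]

/-- The eventually vanishing sequences. -/
def eventuallyZero (T : G →+ G) : AddSubgroup (eventuallyCompatible T) where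
  carrier := {g | ∀ᶠ k in atTop, (g : ℕ → G) k = 0}
  zero_mem' := Eventually.of_forall fun _ => rfl
  add_mem' := by
    intro f g hf hg
    filter_upwards [hf, hg] with k h1 h2
    simp [h1, h2]
  neg_mem' := by
    intro f hf
    filter_upwards [hf] with k h1
    simp [h1]

/-- The stationary inductive limit of `G → G → G → ⋯` with connecting maps `T`: sequences which are
eventually compatible with `T`, two of them being identified if they eventually agree. -/
abbrev StationaryLimit (T : G →+ G) : Type _ := eventuallyCompatible T ⧸ eventuallyZero T

/-- The positive cone of the limit: the classes of eventually positive sequences. -/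
def StationaryLimit.posCone [PartialOrder G] (T : G →+ G) : Set (StationaryLimit T) :=
  {x | ∃ g : eventuallyCompatible T, (∀ᶠ k in atTop, 0 ≤ (g : ℕ → G) k) ∧
    (g : StationaryLimit T) = x}

/-- `T` applied to each term of an eventually compatible sequence. -/
def eventuallyCompatible.map (T : G →+ G) : eventuallyCompatible T →+ eventuallyCompatible T where
  toFun g := ⟨fun k => T ((g : ℕ → G) k), by
    filter_upwards [show ∀ᶠ k in atTop, T ((g : ℕ → G) k) = (g : ℕ → G) (k + 1) from g.2] with k hk
    exact congrArg T hk⟩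
  map_zero' := by ext k; simp
  map_add' f g := by ext k; simp

/-- The map of the limit induced by `T`. -/
def StationaryLimit.star (T : G →+ G) : StationaryLimit T →+ StationaryLimit T :=
  QuotientAddGroup.map _ _ (eventuallyCompatible.map T) (by
    intro g hg
    have hg' : ∀ᶠ k in atTop, (g : ℕ → G) k = 0 := hg
    change ∀ᶠ k in atTop, T ((g : ℕ → G) k) = 0
    filter_upwards [hg'] with k hk
    rw [hk, map_zero])

end Limit

section Matrix

variable {n : ℕ}

/-- Right multiplication `v ↦ v A` on `ℤⁿ`, which has the coordinatewise order. -/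
def rightMul (A : Matrix (Fin n) (Fin n) ℤ) : (Fin n → ℤ) →+ (Fin n → ℤ) :=
  A.vecMulLinear.toAddMonoidHom

/-- The dimension group `G_A`. -/
abbrev MatrixDimGroup (A : Matrix (Fin n) (Fin n) ℤ) : Type := StationaryLimit (rightMul A)

/-- The positive cone `G_A⁺`. -/
def MatrixDimGroup.posCone (A : Matrix (Fin n) (Fin n) ℤ) : Set (MatrixDimGroup A) :=
  StationaryLimit.posCone (rightMul A)

/-- The automorphism `A_*` of `G_A`. -/
def MatrixDimGroup.star (A : Matrix (Fin n) (Fin n) ℤ) : MatrixDimGroup A →+ MatrixDimGroup A :=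
  StationaryLimit.star (rightMul A)

end Matrix

/-- An isomorphism of triples (group, positive cone, endomorphism): a group isomorphism which
carries the positive cone onto the positive cone and intertwines the endomorphisms. -/
def TripleIso {G H : Type*} [AddCommGroup G] [AddCommGroup H] (Gp : Set G) (S : G →+ G)
    (Hp : Set H) (T : H →+ H) : Prop :=
  ∃ Φ : G ≃+ H, Φ '' Gp = Hp ∧ ∀ x, Φ (S x) = T (Φ x)

/-- The point `c` is eventually periodic: some `τ ^ k c` is a periodic point. -/
def IsEventuallyPeriodic (τ : unitInterval → unitInterval) (c : unitInterval) : Prop :=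
  ∃ k : ℕ, τ^[k] c ∈ Function.periodicPts τ

end IntervalDim

open IntervalDim

/-! Write s_x for the characteristic function of [0⁺, x⁻], x in I₁, so that s_0 = 0 and s_1 = 1.
Since f is locally constant on a compact ordered space, it has finitely many jumps, all at points of
I₁; hence the s_x generate C(X, ℤ) (`Disc.mem_of_forall_step_mem`). On [0⁺, c⁻] the map σ preserves
the order and on [c⁺, 1⁻] it reverses it, and τ(c) = 1. Therefore L s_x is s_{τx} - s_{τ0} for x ≤ c
and 2 s_1 - s_{τx} - s_{τ0} for x ≥ c. In short, L s_x = ± s_{τx} modulo s_1 and s_{τ0}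
(`IsUnimodal.transferMap_step`), and everything rests on this formula.

Surjectivity gives τ(0) = 0 or τ(1) = 0, so s_{τ0} is either 0 or 2 s_1 - L s_1. Consequently a
subgroup N with s_1 ∈ N and (L f ∈ N ↔ f ∈ N) contains s_x exactly when it contains s_{τx}. As I₁ is
generated from 0, c, 1 by τ and τ⁻¹, such an N is everything
(`IsUnimodal.mem_of_transferMap_mem_iff`). Applied to the preimage of the submodule generated by
I(0,1), this is cyclicity.

Applied to the functions which some power of L carries into the span V of the s_x with x in a Markov
partition, the same principle shows that every function reaches V. The partition contains 0, c, 1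
and is forward invariant, so L preserves V. In the basis of characteristic functions of the pieces,
L acts on V as v ↦ vA. Sending f to the sequence of coordinates of L^k f, defined for large k,
identifies DG(τ) with G_A. For surjectivity and positivity, some branch of σ is onto, so nonnegative
functions have nonnegative L-preimages. A Markov partition exists when c is eventually periodic
because {0} together with the orbit of c is then finite and forward invariant.

If c is not eventually periodic, its orbit supplies distinct nonzero points x_0 = 1, x_1, ... with L
s_{x_n} = ± s_{x_{n+1}} modulo s_{x_0}, ..., s_{x_n} (`IsUnimodal.exists_triangular_seq`). Thus L^n
s_1 has leading term ± s_{x_n}, and the jump at x_n detects it. No nonzero polynomial in L kills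
s_1, even after applying a power of L. So the generator has zero annihilator and the module is free
of rank one. -/

namespace IntervalDim

/-! ### Transfer of functions supported where the map is injective -/

section Transfer

variable {X : Type*} {σ : X → X} {f : X → ℤ} {s : Set X}

theorem transfer_apply_of_injOn (hs : InjOn σ s) (hf : ∀ y ∉ s, f y = 0) {y : X} (hy : y ∈ s) :
    transfer σ f (σ y) = f y := by
  unfold transfer
  rw [finsum_eq_single _ y, finsum_eq_single _ (show y ∈ σ ⁻¹' {σ y} from rfl)
    (fun h h' => absurd rfl h')]
  intro z hz
  by_cases hzs : z ∈ s
  · have : z ∉ σ ⁻¹' {σ y} := fun h => hz (hs hzs hy h)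
    simp only [this, finsum_false]
  · simp [hf z hzs]

theorem transfer_apply_of_notMem (hf : ∀ y ∉ s, f y = 0) {x : X} (hx : x ∉ σ '' s) :
    transfer σ f x = 0 := by
  unfold transfer
  refine finsum_mem_of_eqOn_zero fun y hy => hf y fun hys => hx ⟨y, hys, hy⟩

/-- Each fibre meets `s` in at most one point, so the fibre sum is 1 or 0. This reduces the
computation of L on step functions to finding images of intervals. -/
theorem transfer_indicator_one (hs : InjOn σ s) :
    transfer σ (s.indicator fun _ => 1) = (σ '' s).indicator fun _ => 1 := by
  have hf : ∀ y ∉ s, s.indicator (fun _ => (1 : ℤ)) y = 0 := fun y hy => indicator_of_notMem hy _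
  funext x
  by_cases hx : x ∈ σ '' s
  · rw [indicator_of_mem hx]
    obtain ⟨y, hy, rfl⟩ := hx
    rw [transfer_apply_of_injOn hs hf hy, indicator_of_mem hy]
  · rw [indicator_of_notMem hx, transfer_apply_of_notMem hf hx]

end Transfer

/-! ### Step functions on the disconnected interval -/

namespace Disc

variable {S : Set unitInterval}

/-- The points of the disconnected interval up to `x⁻`; this is empty for `x = 0`. -/
def below (S : Set unitInterval) (x : unitInterval) : Set (Disc S) :=
  {p | p.proj < x ∨ p.proj = x ∧ p.side = false}

theorem below_eq_Iic {x : unitInterval} (h : x ≠ 0) : below S x = Iic (lower S x) := by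
  ext p
  simp only [below, mem_ofPred_eq, mem_Iic]
  constructor
  · rintro (h1 | ⟨h1, h2⟩)
    · exact (lt_lower_iff.2 h1).le
    · exact (ext' (by simpa using h1) (by rw [h2, side_lower h])).le
  · intro hp
    rcases hp.lt_or_eq with h1 | rfl
    · exact Or.inl (lt_lower_iff.1 h1)
    · exact Or.inr ⟨by simp, side_lower h⟩

/-- This is where `below` differs from `Iic (lower S x)`, which at 0 would be the singleton of 0⁺.
The choice gives s_0 = 0 and lets intervals be written as differences without exceptions at 0. -/
theorem below_zero : below S 0 = ∅ := by
  ext p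
  simp only [below, mem_ofPred_eq, mem_empty_iff_false, iff_false, not_or, not_and]
  exact ⟨not_lt_bot (α := unitInterval), fun h h' => p.side_false h' h⟩

theorem below_one : below S 1 = univ := by
  rw [below_eq_Iic one_ne_zero]
  exact eq_univ_of_forall le_lower_one

theorem compl_below {x : unitInterval} (hx : x ∈ S) (h1 : x ≠ 1) :
    (below S x)ᶜ = Ici (upper S x) := by
  by_cases h0 : x = 0
  · subst h0
    rw [below_zero, compl_empty, upper_zero_eq]
    exact (eq_univ_of_forall lower_zero_le).symm
  · rw [below_eq_Iic h0, compl_Iic]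
    ext p
    exact (upper_le_iff hx h0 h1).symm

theorem isClopen_below {x : unitInterval} (hx : x ∈ S) : IsClopen (below S x) := by
  by_cases h0 : x = 0
  · subst h0
    rw [below_zero]
    exact isClopen_empty
  · rw [below_eq_Iic h0]
    exact ⟨isClosed_Iic, isOpen_Iic_lower hx h0⟩

theorem below_mono : Monotone (below S) := by
  rintro x y h p (hp | ⟨hp, hp'⟩)
  · exact Or.inl (hp.trans_le h)
  · rcases h.lt_or_eq with h | rfl
    · exact Or.inl (hp ▸ h)
    · exact Or.inr ⟨hp, hp'⟩

theorem Icc_eq_below_diff {a b : unitInterval} (ha : a ∈ S) (hab : a < b) :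
    Icc (upper S a) (lower S b) = below S b \ below S a := by
  rw [sdiff_eq, compl_below ha (hab.trans_le le_top).ne,
    below_eq_Iic (bot_le.trans_lt hab).ne', inter_comm, Ici_inter_Iic]

/-- The characteristic function of `[0⁺, x⁻]`. -/
noncomputable def step (x : S) : C(Disc S, ℤ) :=
  ⟨(below S x).indicator fun _ => 1,
    continuous_const.indicator (by simp [(isClopen_below x.2).frontier_eq])⟩

theorem step_apply (x : S) (p : Disc S) :
    step x p = (below S x).indicator (fun _ => (1 : ℤ)) p := rfl

theorem step_apply_of_mem {x : S} {p : Disc S} (h : p ∈ below S x) : step x p = 1 :=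
  (step_apply x p).trans (indicator_of_mem h _)

theorem step_apply_of_notMem {x : S} {p : Disc S} (h : p ∉ below S x) : step x p = 0 :=
  (step_apply x p).trans (indicator_of_notMem h _)

theorem step_zero (h0 : (0 : unitInterval) ∈ S) : step ⟨0, h0⟩ = 0 := by
  ext p
  exact step_apply_of_notMem (by simp [below_zero])

theorem step_one_apply (h1 : (1 : unitInterval) ∈ S) (p : Disc S) : step ⟨1, h1⟩ p = 1 :=
  step_apply_of_mem (by simp [below_one])

theorem step_sub_step {a b : S} (hab : a ≤ b) :
    ⇑(step b - step a) = (below S b \ below S a).indicator fun _ => (1 : ℤ) := by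
  funext p
  have hs : p ∈ below S a → p ∈ below S b := fun h => below_mono hab h
  by_cases hb : p ∈ below S b <;> by_cases ha : p ∈ below S a <;>
    simp_all [step_apply]

theorem lower_mem_below {x y : unitInterval} (hx : x ≠ 0) : lower S x ∈ below S y ↔ x ≤ y := by
  simp [below, side_lower hx, le_iff_lt_or_eq]

theorem upper_mem_below {x y : unitInterval} (hx : x ∈ S) (h1 : x ≠ 1) :
    upper S x ∈ below S y ↔ x < y := by
  simp [below, side_upper (Or.inr ⟨hx, h1⟩)]

theorem eq_upper_or_le_lower {p : Disc S} {x : unitInterval} (h : p ≤ upper S x) :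
    p = upper S x ∨ p ≤ lower S x := by
  have h' : p.proj ≤ x := by simpa using proj_mono h
  rcases h'.lt_or_eq with h' | rfl
  · exact Or.inr (lt_lower_iff.2 h').le
  · rcases eq_lower_or_upper p with h | h
    · exact Or.inr h.le
    · exact Or.inl h

/-- The integer valued continuous functions are the combinations of the characteristic functions of
the intervals `[0⁺, x⁻]`. -/
theorem mem_of_forall_step_mem (h1 : (1 : unitInterval) ∈ S)
    {G : AddSubgroup C(Disc S, ℤ)} (hG : ∀ x : S, step x ∈ G) (f : C(Disc S, ℤ)) : f ∈ G := by
  -- Continuous induction along the interval: A collects the x for which f, frozen at its value at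
  -- x⁺ from there on, lies in G. It is shown that sup A belongs to A and equals 1.
  let A : Set unitInterval := {x | ∃ g ∈ G, (∀ p ≤ upper S x, g p = f p) ∧
    ∀ p, upper S x ≤ p → g p = f (upper S x)}
  have h0A : (0 : unitInterval) ∈ A := by
    have hv : ∀ p, (f (upper S 0) • step ⟨1, h1⟩ : C(Disc S, ℤ)) p = f (upper S 0) := fun p => by
      simp [step_one_apply]
    refine ⟨_, G.zsmul_mem (hG ⟨1, h1⟩) (f (upper S 0)), fun p hp => ?_, fun p _ => hv p⟩
    rw [hv, le_antisymm hp (upper_zero_eq (S := S) ▸ lower_zero_le p)]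
  have hlub : IsLUB A (sSup A) := isLUB_sSup A
  set s := sSup A
  have hlc : ∀ q, {p | f p = f q} ∈ nhds q := fun q =>
    ((isOpen_discrete {f q}).preimage f.continuous).mem_nhds rfl
  have hsA : s ∈ A := by
    by_cases hs0 : s = 0
    · rwa [hs0]
    -- f is constant just to the left of s⁻, so the approximant of a nearby x in A already agrees
    -- with f up to s⁻ and keeps the value f(s⁻) afterwards.
    obtain ⟨l, hl, hls⟩ := exists_Ioc_subset_of_mem_nhds (hlc (lower S s))
      ⟨lower S 0, lt_lower_iff.2 (by rw [proj_lower]; exact bot_lt_iff_ne_bot.2 hs0)⟩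
    obtain ⟨x, hxA, hlx, hxs⟩ := hlub.exists_between (lt_lower_iff.1 hl)
    rcases hxs.eq_or_lt with rfl | hxs
    · exact hxA
    obtain ⟨g, hg, hg1, hg2⟩ := hxA
    have hfx : f (upper S x) = f (lower S s) :=
      hls ⟨lt_iff.2 (Or.inl (by simpa using hlx)), (lt_lower_iff.2 (by simpa using hxs)).le⟩
    have hgl : ∀ p ≤ lower S s, g p = f p := by
      intro p hp
      rcases le_or_gt p (upper S x) with h | h
      · exact hg1 p h
      · rw [hg2 p h.le, hfx]
        refine (hls ⟨?_, hp⟩).symm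
        exact lt_trans (lt_iff.2 (Or.inl (by simpa using hlx))) h
    have hgu : ∀ p, upper S s ≤ p → g p = f (lower S s) := by
      intro p hp
      rw [← hfx]
      refine hg2 p (le_trans ?_ hp)
      exact (lt_iff.2 (Or.inl (by simpa using hxs))).le
    by_cases hs : s ∈ S ∧ s ≠ 1
    · have hc := compl_below hs.1 hs.2
      -- The only error left is the jump of f at s, and s_1 - s_s is the characteristic function of
      -- [s⁺, 1⁻].
      refine ⟨g + (f (upper S s) - f (lower S s)) • (step ⟨1, h1⟩ - step ⟨s, hs.1⟩),
        G.add_mem hg (G.zsmul_mem (G.sub_mem (hG _) (hG _)) _), ?_⟩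
      have hup : ∀ p, upper S s ≤ p → (g + (f (upper S s) - f (lower S s)) •
          (step ⟨1, h1⟩ - step ⟨s, hs.1⟩)) p = f (upper S s) := by
        intro p hp
        have : p ∉ below S s := by
          rw [← mem_compl_iff, hc]
          exact hp
        simp [step_one_apply, step_apply_of_notMem (x := ⟨s, hs.1⟩) this, hgu p hp]
      refine ⟨fun p hp => ?_, hup⟩
      rcases eq_upper_or_le_lower hp with rfl | hp
      · exact hup _ le_rfl
      · have : p ∈ below S s := by
          rw [below_eq_Iic hs0]
          exact hp
        simp [step_one_apply, step_apply_of_mem (x := ⟨s, hs.1⟩) this, hgl p hp]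
    · have hul : upper S s = lower S s :=
        ext' (by simp) (by rw [side_upper_not (by tauto), side_lower hs0])
      exact ⟨g, hg, fun p hp => hgl p (hul ▸ hp), fun p hp => by rw [hgu p hp, hul]⟩
  have hs1 : s = 1 := by
    by_contra hs1
    have hs1' : s < 1 := lt_top_iff_ne_top.2 hs1
    -- If s < 1, f is constant a little beyond s⁺, and the approximant at s also works for some y >
    -- s.
    obtain ⟨r, hr, hrs⟩ := exists_Ico_subset_of_mem_nhds (hlc (upper S s))
      ⟨lower S 1, upper_lt_iff.2 (by simpa using hs1')⟩
    obtain ⟨y, hsy, hyr⟩ := exists_between (upper_lt_iff.1 hr)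
    obtain ⟨g, hg, hg1, hg2⟩ := hsA
    have hy1 : upper S y < r := upper_lt_iff.2 hyr
    have hy2 : upper S s ≤ upper S y := (upper_lt_iff.2 (by simpa using hsy)).le
    refine not_le.2 hsy (hlub.1 ⟨g, hg, fun p hp => ?_, fun p hp => ?_⟩)
    · rcases le_total p (upper S s) with h | h
      · exact hg1 p h
      · rw [hg2 p h]
        exact (hrs ⟨h, hp.trans_lt hy1⟩).symm
    · rw [hg2 p (hy2.trans hp)]
      exact (hrs ⟨hy2, hy1⟩).symm
  obtain ⟨g, hg, hg1, -⟩ := hsA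
  have : g = f := by
    ext p
    refine hg1 p ?_
    rw [hs1, ← lower_one_eq]
    exact le_lower_one p
  rwa [← this]

end Disc

/-! ### The transfer map on step functions -/

section Orbit

variable {τ : unitInterval → unitInterval} {c : unitInterval}

/-- The map `τ` on the generalized orbit. -/
def genOrbit.map (x : genOrbit τ c) : genOrbit τ c := ⟨τ x, map_mem_genOrbit_iff.2 x.2⟩

/-- The set where P holds contains {0, c, 1}; the two directions of `hP` make it closed under τ and
τ⁻¹, so it contains the smallest such set. -/
theorem genOrbit.induction {P : genOrbit τ c → Prop} (h0 : P ⟨0, zero_mem_genOrbit⟩)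
    (hc : P ⟨c, crit_mem_genOrbit⟩) (h1 : P ⟨1, one_mem_genOrbit⟩)
    (hP : ∀ x, P (genOrbit.map x) ↔ P x) (x : genOrbit τ c) : P x := by
  suffices H : ∃ hx : (x : unitInterval) ∈ genOrbit τ c, P ⟨x, hx⟩ from H.2
  refine x.2 {x | ∃ hx : x ∈ genOrbit τ c, P ⟨x, hx⟩} ⟨?_, ?_, ?_⟩
  · rintro y (rfl | rfl | rfl)
    · exact ⟨_, h0⟩
    · exact ⟨_, hc⟩
    · exact ⟨_, h1⟩
  · rintro _ ⟨y, ⟨hy, hPy⟩, rfl⟩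
    exact ⟨_, (hP ⟨y, hy⟩).2 hPy⟩
  · rintro y ⟨hy, hPy⟩
    exact ⟨map_mem_genOrbit_iff.1 hy, (hP ⟨y, _⟩).1 hPy⟩

theorem IsUnimodal.map_crit (h : IsUnimodal τ c) (hs : Function.Surjective τ) : τ c = 1 := by
  obtain ⟨x, hx⟩ := hs 1
  refine le_antisymm le_top (hx ▸ ?_)
  rcases lt_trichotomy x c with h1 | rfl | h1
  · exact (h.lt_max_left h1).le
  · exact le_rfl
  · exact (h.lt_max_right h1).le

theorem IsUnimodal.map_zero_or_map_one (h : IsUnimodal τ c) (hs : Function.Surjective τ) :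
    τ 0 = 0 ∨ τ 1 = 0 := by
  obtain ⟨x, hx⟩ := hs 0
  rcases le_total x c with h1 | h1
  · left
    refine le_antisymm ?_ bot_le
    exact (h.strictMonoOn.monotoneOn ⟨le_rfl, h.pos.le⟩ ⟨bot_le, h1⟩ bot_le).trans_eq hx
  · right
    refine le_antisymm ?_ bot_le
    exact (h.strictAntiOn.antitoneOn ⟨h1, le_top⟩ ⟨h.lt_one.le, le_rfl⟩ le_top).trans_eq hx

theorem IsUnimodal.lower_lt_upper (h : IsUnimodal τ c) :
    Disc.lower (genOrbit τ c) c < Disc.upper _ c :=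
  Disc.lower_lt_upper crit_mem_genOrbit h.pos.ne' h.lt_one.ne

/-- The known image of the whole increasing branch is cut at σ(x⁻) = τ(x)⁻. At x = 0 both sides are
empty. -/
theorem IsUnimodal.image_below (h : IsUnimodal τ c) (x : genOrbit τ c)
    (hx : (x : unitInterval) ≤ c) :
    sigma τ c '' Disc.below _ x = Disc.below _ (τ x) \ Disc.below _ (τ 0) := by
  by_cases hx0 : (x : unitInterval) = 0
  · simp [hx0, Disc.below_zero]
  have hx0' : 0 < (x : unitInterval) := bot_lt_iff_ne_bot.2 hx0
  have hτ : τ 0 < τ x := h.strictMonoOn ⟨le_rfl, h.pos.le⟩ ⟨bot_le, hx⟩ hx0'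
  have hxc : Disc.lower (genOrbit τ c) x ≤ Disc.lower _ c := by
    rcases hx.lt_or_eq with hx | hx
    · exact (Disc.lt_lower_iff.2 (by simpa using hx)).le
    · rw [hx]
  have himg := h.image_left
  rw [Disc.Icc_eq_below_diff (map_mem_genOrbit_iff.2 zero_mem_genOrbit) (h.lt_max_left h.pos)]
    at himg
  have e : sigma τ c (Disc.lower _ x) = Disc.lower _ (τ x) := by
    unfold sigma
    rw [if_pos hxc, Disc.side_lower hx0]
    simp [Disc.signed]
  rw [Disc.below_eq_Iic hx0, Disc.below_eq_Iic (bot_le.trans_lt hτ).ne']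
  apply Subset.antisymm
  · rintro _ ⟨p, hp, rfl⟩
    have hpc : p ∈ Iic (Disc.lower (genOrbit τ c) c) := le_trans hp hxc
    exact ⟨e ▸ h.strictMono_sigma.monotoneOn hpc hxc hp, (himg ▸ mem_image_of_mem _ hpc).2⟩
  · rintro q ⟨hq1, hq2⟩
    have : q ∈ Disc.below (genOrbit τ c) (τ c) := by
      rw [← Disc.below_eq_Iic (bot_le.trans_lt hτ).ne'] at hq1
      exact Disc.below_mono (h.strictMonoOn.monotoneOn ⟨bot_le, hx⟩ ⟨h.pos.le, le_rfl⟩ hx) hq1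
    obtain ⟨p, hp, rfl⟩ := himg.symm.subset ⟨this, hq2⟩
    rw [← e, mem_Iic, h.strictMono_sigma.le_iff_le hp hxc] at hq1
    exact ⟨p, hq1, rfl⟩

/-- Here σ reverses order, so x⁺ goes to τ(x)⁻ and the points beyond x are those landing below τ(x).
The end x = 1 is separate, as 1 has no right-hand copy to cut at. -/
theorem IsUnimodal.image_below_diff (h : IsUnimodal τ c) (x : genOrbit τ c)
    (hx : c ≤ (x : unitInterval)) :
    sigma τ c '' (Disc.below _ x \ Disc.below _ c) = Disc.below _ (τ c) \ Disc.below _ (τ x) := by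
  have himg := h.image_right
  have hcc := Disc.compl_below (crit_mem_genOrbit (τ := τ) (c := c)) h.lt_one.ne
  rw [Disc.Icc_eq_below_diff (map_mem_genOrbit_iff.2 one_mem_genOrbit) (h.lt_max_right h.lt_one)]
    at himg
  by_cases hx1 : (x : unitInterval) = 1
  · rw [hx1, Disc.below_one, ← compl_eq_univ_sdiff, hcc, himg]
  have hx1' : (x : unitInterval) < 1 := lt_top_iff_ne_top.2 hx1
  have hτ : τ 1 < τ x := h.strictAntiOn ⟨hx, le_top⟩ ⟨h.lt_one.le, le_rfl⟩ hx1'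
  have hxc : Disc.upper (genOrbit τ c) x ∈ Ici (Disc.upper (genOrbit τ c) c) := by
    rcases hx.lt_or_eq with hx | hx
    · exact (Disc.upper_lt_iff.2 (by simpa using hx)).le
    · rw [← hx, mem_Ici]
  have e : sigma τ c (Disc.upper _ x) = Disc.lower _ (τ x) := by
    unfold sigma
    rw [if_neg (not_le.2 (h.lower_lt_upper.trans_le hxc)), Disc.side_upper (Or.inr ⟨x.2, hx1⟩)]
    simp [Disc.signed]
  have key : ∀ p ∈ Ici (Disc.upper (genOrbit τ c) c),
      (sigma τ c p ∈ Disc.below (genOrbit τ c) (τ x) ↔ p ∉ Disc.below (genOrbit τ c) x) := by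
    intro p hp
    rw [← mem_compl_iff, Disc.compl_below x.2 hx1, Disc.below_eq_Iic (bot_le.trans_lt hτ).ne', ← e]
    exact h.strictAnti_sigma.le_iff_ge hp hxc
  rw [sdiff_eq, hcc]
  apply Subset.antisymm
  · rintro _ ⟨p, ⟨hp, hpc⟩, rfl⟩
    refine ⟨(himg ▸ mem_image_of_mem _ hpc).1, fun h' => (key p hpc).1 h' hp⟩
  · rintro q ⟨hq1, hq2⟩
    have hq3 : q ∉ Disc.below (genOrbit τ c) (τ 1) := fun h' => hq2 (Disc.below_mono hτ.le h')
    obtain ⟨p, hp, rfl⟩ := himg.symm.subset ⟨hq1, hq3⟩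
    refine ⟨p, ⟨?_, hp⟩, rfl⟩
    by_contra h'
    exact hq2 ((key p hp).2 h')

/-- The transfer map on `C(X, ℤ)`. -/
noncomputable abbrev IsUnimodal.transferMap (h : IsUnimodal τ c) :
    C(DiscSpace τ c, ℤ) →+ C(DiscSpace τ c, ℤ) :=
  transferHom (sigma τ c) h.isPiecewiseHomeo

theorem IsUnimodal.coe_transferMap (h : IsUnimodal τ c) (f : C(DiscSpace τ c, ℤ)) :
    ⇑(h.transferMap f) = transfer (sigma τ c) f := rfl

theorem IsUnimodal.transferMap_step_left (h : IsUnimodal τ c) (x : genOrbit τ c)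
    (hx : (x : unitInterval) ≤ c) :
    h.transferMap (Disc.step x) =
      Disc.step (genOrbit.map x) - Disc.step (genOrbit.map ⟨0, zero_mem_genOrbit⟩) := by
  refine DFunLike.coe_injective ?_
  rw [Disc.step_sub_step (h.strictMonoOn.monotoneOn ⟨le_rfl, h.pos.le⟩ ⟨bot_le, hx⟩ bot_le)]
  refine Eq.trans (transfer_indicator_one (h.strictMono_sigma.injOn.mono ?_)) ?_
  · rw [← Disc.below_eq_Iic h.pos.ne']
    exact Disc.below_mono hx
  · rw [h.image_below x hx]
    rfl

theorem IsUnimodal.transferMap_step_sub (h : IsUnimodal τ c) (x : genOrbit τ c)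
    (hx : c ≤ (x : unitInterval)) :
    h.transferMap (Disc.step x - Disc.step ⟨c, crit_mem_genOrbit⟩) =
      Disc.step (genOrbit.map ⟨c, crit_mem_genOrbit⟩) - Disc.step (genOrbit.map x) := by
  refine DFunLike.coe_injective ?_
  rw [Disc.step_sub_step (h.strictAntiOn.antitoneOn ⟨le_rfl, h.lt_one.le⟩ ⟨hx, le_top⟩ hx)]
  rw [h.coe_transferMap, Disc.step_sub_step hx]
  refine Eq.trans (transfer_indicator_one (h.strictAnti_sigma.injOn.mono ?_)) ?_
  · rw [← Disc.compl_below crit_mem_genOrbit h.lt_one.ne]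
    exact fun p hp => hp.2
  · rw [h.image_below_diff x hx]
    rfl

/-- Split s_x as s_c + (s_x - s_c), one summand for each branch. Each branch reaches up to τ(c) = 1
and contributes one s_1. -/
theorem IsUnimodal.transferMap_step_right (h : IsUnimodal τ c) (hs : Function.Surjective τ)
    (x : genOrbit τ c) (hx : c ≤ (x : unitInterval)) :
    h.transferMap (Disc.step x) = (2 : ℤ) • Disc.step ⟨1, one_mem_genOrbit⟩ -
      Disc.step (genOrbit.map x) - Disc.step (genOrbit.map ⟨0, zero_mem_genOrbit⟩) := by
  have h1 := h.transferMap_step_sub x hx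
  have h2 := h.transferMap_step_left ⟨c, crit_mem_genOrbit⟩ le_rfl
  have h3 : genOrbit.map ⟨c, crit_mem_genOrbit⟩ = (⟨1, one_mem_genOrbit⟩ : genOrbit τ c) :=
    Subtype.ext (h.map_crit hs)
  rw [h3] at h1 h2
  rw [map_sub, h2] at h1
  rw [sub_eq_iff_eq_add.1 h1, two_zsmul]
  abel

/-- The form common to both branches: up to sign and modulo s_1 and s_{τ0}, L moves s_x to s_{τx}.
-/
theorem IsUnimodal.transferMap_step (h : IsUnimodal τ c) (hs : Function.Surjective τ)
    (x : genOrbit τ c) : ∃ (ε k : ℤ), (ε = 1 ∨ ε = -1) ∧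
      h.transferMap (Disc.step x) = ε • Disc.step (genOrbit.map x) +
        k • Disc.step ⟨1, one_mem_genOrbit⟩ -
        Disc.step (genOrbit.map ⟨0, zero_mem_genOrbit⟩) := by
  rcases le_total (x : unitInterval) c with hx | hx
  · exact ⟨1, 0, Or.inl rfl, by rw [h.transferMap_step_left x hx]; simp⟩
  · exact ⟨-1, 2, Or.inr rfl, by rw [h.transferMap_step_right hs x hx]; simp; abel⟩

/-- A subgroup of `C(X, ℤ)` which contains the constants and is invariant under the transfer map and
under preimages by it is everything. -/
theorem IsUnimodal.mem_of_transferMap_mem_iff (h : IsUnimodal τ c) (hs : Function.Surjective τ)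
    {N : AddSubgroup C(DiscSpace τ c, ℤ)} (hN : ∀ f, h.transferMap f ∈ N ↔ f ∈ N)
    (h1 : Disc.step ⟨1, one_mem_genOrbit⟩ ∈ N) (f : C(DiscSpace τ c, ℤ)) : f ∈ N := by
  have h0 : Disc.step ⟨0, zero_mem_genOrbit (τ := τ) (c := c)⟩ ∈ N := by
    rw [Disc.step_zero]
    exact N.zero_mem
  -- If τ(1) = 0, the formula at x = 1 reads L s_1 = 2 s_1 - s_{τ0}, which puts s_{τ0} in N.
  have h01 : Disc.step (genOrbit.map ⟨0, zero_mem_genOrbit (τ := τ) (c := c)⟩) ∈ N := by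
    rcases h.map_zero_or_map_one hs with hz | hz
    · rwa [show genOrbit.map ⟨0, zero_mem_genOrbit⟩ = (⟨0, zero_mem_genOrbit⟩ : genOrbit τ c) from
        Subtype.ext hz]
    · have := h.transferMap_step_right hs ⟨1, one_mem_genOrbit⟩ le_top
      rw [show genOrbit.map ⟨1, one_mem_genOrbit⟩ = (⟨0, zero_mem_genOrbit⟩ : genOrbit τ c) from
        Subtype.ext hz, Disc.step_zero, sub_zero] at this
      rw [← sub_eq_iff_eq_add.2 (sub_eq_iff_eq_add'.1 this.symm)]
      exact N.sub_mem (N.zsmul_mem h1 2) ((hN _).2 h1)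
  -- The coefficient of s_{τx} is a unit of ℤ; this is what permits passing back from x to τ(x) as
  -- well as forward.
  have hiff : ∀ x : genOrbit τ c, Disc.step (genOrbit.map x) ∈ N ↔ Disc.step x ∈ N := by
    intro x
    obtain ⟨ε, k, hε, he⟩ := h.transferMap_step hs x
    rw [← hN (Disc.step x), he, sub_eq_add_neg, N.add_mem_cancel_right (N.neg_mem h01),
      N.add_mem_cancel_right (N.zsmul_mem h1 k)]
    rcases hε with rfl | rfl <;> simp
  have hall : ∀ x : genOrbit τ c, Disc.step x ∈ N := by
    refine genOrbit.induction h0 ((hiff _).1 ?_) h1 hiff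
    rwa [show genOrbit.map ⟨c, crit_mem_genOrbit⟩ = (⟨1, one_mem_genOrbit⟩ : genOrbit τ c) from
      Subtype.ext (h.map_crit hs)]
  exact Disc.mem_of_forall_step_mem one_mem_genOrbit hall f

end Orbit

/-! ### Laurent modules and cyclicity -/

section Cyclic

variable {G : Type*} [AddCommGroup G]

theorem laurentModule_T_smul (e : G ≃+ G) (x : G) :
    letI := laurentModule e
    (LaurentPolynomial.T 1 : ℤ[T;T⁻¹]) • x = e x := by
  let _ := laurentModule e
  have := laurentModule_C_mul_T_smul e 1 1 x
  rw [map_one, one_mul, one_zsmul, zpow_one] at this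
  exact this

theorem laurentModule_T_nat_smul (e : G ≃+ G) (n : ℕ) (x : G) :
    letI := laurentModule e
    (LaurentPolynomial.T n : ℤ[T;T⁻¹]) • x = e^[n] x := by
  let _ := laurentModule e
  induction n generalizing x with
  | zero => simp
  | succ n ih =>
    rw [Nat.cast_succ, LaurentPolynomial.T_add, mul_smul, laurentModule_T_smul, ih,
      Function.iterate_succ_apply]

theorem laurentModule_C_smul (e : G ≃+ G) (z : ℤ) (x : G) :
    letI := laurentModule e
    (LaurentPolynomial.C z : ℤ[T;T⁻¹]) • x = z • x := by
  let _ := laurentModule e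
  have := laurentModule_C_mul_T_smul e z 0 x
  simpa using this

/-- Submodules are stable under T⁻¹ as well as T. Preimages of submodules in C(X, ℤ) thereby satisfy
the criterion of `IsUnimodal.mem_of_transferMap_mem_iff`. -/
theorem laurentModule_mem_iff (e : G ≃+ G) :
    letI := laurentModule e
    ∀ (M : Submodule ℤ[T;T⁻¹] G) (x : G), e x ∈ M ↔ x ∈ M := by
  let _ := laurentModule e
  intro M x
  rw [← laurentModule_T_smul]
  refine ⟨fun h => ?_, M.smul_mem _⟩
  have := M.smul_mem (LaurentPolynomial.T (-1)) h
  rwa [← mul_smul, ← LaurentPolynomial.T_add, neg_add_cancel, LaurentPolynomial.T_zero,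
    one_smul] at this

variable {τ : unitInterval → unitInterval} {c : unitInterval}

theorem DG.interval_zero_one (h : IsUnimodal τ c) :
    DG.interval h 0 1 zero_mem_genOrbit one_mem_genOrbit zero_lt_one =
      QuotientAddGroup.mk (Disc.step ⟨1, one_mem_genOrbit⟩) := by
  unfold DG.interval
  congr 1
  ext p
  change indicator _ (fun _ => (1 : ℤ)) p = indicator _ (fun _ => (1 : ℤ)) p
  rw [Disc.Icc_eq_below_diff zero_mem_genOrbit zero_lt_one, Disc.below_zero, sdiff_empty]

/-- The dimension module of a surjective unimodal map is generated by `I(0, 1)`. -/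
theorem DG.span_interval (h : IsUnimodal τ c) (hs : Function.Surjective τ) :
    letI : Module ℤ[T;T⁻¹] (DG h) := DG.module h hs
    Submodule.span ℤ[T;T⁻¹]
      {DG.interval h 0 1 zero_mem_genOrbit one_mem_genOrbit zero_lt_one} = ⊤ := by
  let _ : Module ℤ[T;T⁻¹] (DG h) := DG.module h hs
  have hu := Submodule.mem_span_singleton_self (R := ℤ[T;T⁻¹])
    (DG.interval h 0 1 zero_mem_genOrbit one_mem_genOrbit zero_lt_one)
  set M := Submodule.span ℤ[T;T⁻¹]
    {DG.interval h 0 1 zero_mem_genOrbit one_mem_genOrbit zero_lt_one}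
  have hM : ∀ f, h.transferMap f ∈ M.toAddSubgroup.comap (QuotientAddGroup.mk' _) ↔
      f ∈ M.toAddSubgroup.comap (QuotientAddGroup.mk' _) := fun f =>
    laurentModule_mem_iff (DimGroup.starAut (sigma τ c) h.isPiecewiseHomeo
      (h.sigma_surjective hs)) M (QuotientAddGroup.mk f)
  have h1 : Disc.step ⟨1, one_mem_genOrbit⟩ ∈
      M.toAddSubgroup.comap (QuotientAddGroup.mk' (eventualKer (sigma τ c) h.isPiecewiseHomeo)) := by
    rw [DG.interval_zero_one] at hu
    exact hu
  refine Submodule.eq_top_iff'.2 fun x => ?_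
  induction x using QuotientAddGroup.induction_on with
  | H f => exact h.mem_of_transferMap_mem_iff hs hM h1 f

end Cyclic

/-! ### Triangular systems and dual functionals -/

/-- The iterates of an endomorphism of an additive group, as homomorphisms. -/
def iterateHom {A : Type*} [AddCommGroup A] (L : A →+ A) (n : ℕ) : A →+ A where
  toFun := L^[n]
  map_zero' := iterate_map_zero L n
  map_add' := iterate_map_add L n

section Triangular

variable {A : Type*} [AddCommGroup A] {L : A →+ A} {v : ℕ → A} {ψ : ℕ → A →+ ℤ}

theorem dual_eq_zero_of_mem_closure (hψ : ∀ n m, ψ n (v m) = if n = m then 1 else 0) {n m : ℕ}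
    (hmn : m ≤ n) {a : A} (ha : a ∈ AddSubgroup.closure (v '' Iio m)) : ψ n a = 0 := by
  have : AddSubgroup.closure (v '' Iio m) ≤ (ψ n).ker := by
    rw [AddSubgroup.closure_le]
    rintro _ ⟨i, hi, rfl⟩
    have : n ≠ i := ((mem_Iio.1 hi).trans_le hmn).ne'
    simp [hψ, this]
  exact this ha

/-- L raises the index filtration by at most one step, with a sign as leading coefficient; the signs
multiply along the iterates. -/
theorem iterate_sub_mem_closure (hv : ∀ n, ∃ ε : ℤ, (ε = 1 ∨ ε = -1) ∧
      L (v n) - ε • v (n + 1) ∈ AddSubgroup.closure (v '' Iio (n + 1))) (n : ℕ) :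
    ∃ ε : ℤ, (ε = 1 ∨ ε = -1) ∧
      L^[n] (v 0) - ε • v n ∈ AddSubgroup.closure (v '' Iio n) := by
  have hmem : ∀ {i n : ℕ}, i < n → v i ∈ AddSubgroup.closure (v '' Iio n) := fun h =>
    AddSubgroup.subset_closure ⟨_, h, rfl⟩
  have hmono : ∀ {i n : ℕ}, i ≤ n →
      AddSubgroup.closure (v '' Iio i) ≤ AddSubgroup.closure (v '' Iio n) := fun h =>
    AddSubgroup.closure_mono (image_mono (Iio_subset_Iio h))
  have hL : ∀ n, AddSubgroup.closure (v '' Iio n) ≤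
      (AddSubgroup.closure (v '' Iio (n + 1))).comap L := by
    intro n
    rw [AddSubgroup.closure_le]
    rintro _ ⟨i, hi, rfl⟩
    have hi : i < n := hi
    obtain ⟨ε, -, h⟩ := hv i
    have := AddSubgroup.add_mem _ (hmono (by omega : i + 1 ≤ n + 1) h)
      (AddSubgroup.zsmul_mem _ (hmem (by omega : i + 1 < n + 1)) ε)
    rwa [sub_add_cancel] at this
  induction n with
  | zero => exact ⟨1, Or.inl rfl, by simp⟩
  | succ n ih =>
    obtain ⟨ε, hε, h⟩ := ih
    obtain ⟨δ, hδ, h'⟩ := hv n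
    refine ⟨ε * δ, by rcases hε with rfl | rfl <;> rcases hδ with rfl | rfl <;> simp, ?_⟩
    have hLh : L (L^[n] (v 0) - ε • v n) ∈ AddSubgroup.closure (v '' Iio (n + 1)) := hL n h
    have := AddSubgroup.add_mem _ hLh (AddSubgroup.zsmul_mem _ h' ε)
    rw [map_sub, map_zsmul, zsmul_sub, smul_smul, sub_add_sub_cancel] at this
    rwa [Function.iterate_succ_apply']

/-- The matrix of the functionals against the iterates of `v 0` is triangular with diagonal entries
±1. This is the whole source of linear independence. -/
theorem dual_iterate (hψ : ∀ n m, ψ n (v m) = if n = m then 1 else 0)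
    (hv : ∀ n, ∃ ε : ℤ, (ε = 1 ∨ ε = -1) ∧
      L (v n) - ε • v (n + 1) ∈ AddSubgroup.closure (v '' Iio (n + 1))) {m n : ℕ} (hmn : m ≤ n) :
    ψ n (L^[m] (v 0)) = 0 ↔ m < n := by
  obtain ⟨ε, hε, h⟩ := iterate_sub_mem_closure hv m
  have := dual_eq_zero_of_mem_closure hψ hmn h
  rw [map_sub, sub_eq_zero, map_zsmul, hψ] at this
  rw [this]
  rcases hmn.lt_or_eq with h | rfl
  · simp [h, h.ne']
  · rcases hε with rfl | rfl <;> simp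

end Triangular

/-! ### Jumps of step functions -/

namespace Disc

variable {S : Set unitInterval}

open Classical in
/-- The jump of a function at a point of `S`. -/
noncomputable def jump (x : S) : C(Disc S, ℤ) →+ ℤ :=
  AddMonoidHom.mk' (fun f => f (lower S x) - if (x : unitInterval) = 1 then 0 else f (upper S x))
    (by intro f g; split_ifs <;> simp; abel)

/-- s_y drops from 1 at y⁻ to 0 at y⁺ and is constant elsewhere. At 1 the missing right-hand value
is taken to be 0, so s_1 has jump 1 there; 0 is excluded because s_0 = 0. -/
theorem jump_step {x y : S} (hx : (x : unitInterval) ≠ 0) :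
    jump x (step y) = if x = y then 1 else 0 := by
  classical
  change step y (lower S x) - (if (x : unitInterval) = 1 then 0 else step y (upper S x)) = _
  have hl : step y (lower S x) = if (x : unitInterval) ≤ y then 1 else 0 := by
    rw [step_apply, indicator_apply, lower_mem_below hx]
  rw [hl]
  by_cases h1 : (x : unitInterval) = 1
  · have : (x : unitInterval) ≤ y ↔ x = y := by
      rw [Subtype.ext_iff, h1]
      exact ⟨fun h => le_antisymm h le_top, fun h => h.le⟩
    simp [h1, ← this]
  · have hu : step y (upper S x) = if (x : unitInterval) < y then 1 else 0 := by
      rw [step_apply, indicator_apply, upper_mem_below x.2 h1]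
    rw [if_neg h1, hu]
    rcases lt_trichotomy x y with h | h | h
    · simp [h, h.le, h.ne]
    · simp [h]
    · simp [h.not_gt, h.not_ge, h.ne']

end Disc

/-! ### Critical points that are not eventually periodic: freeness -/

variable {τ : unitInterval → unitInterval} {c : unitInterval}

theorem injective_iterate_of_not_isEventuallyPeriodic (hp : ¬ IsEventuallyPeriodic τ c) :
    Function.Injective fun n => τ^[n] c := by
  have key : ∀ i j, i < j → τ^[i] c ≠ τ^[j] c := by
    intro i j hij h
    refine hp ⟨i, j - i, Nat.sub_pos_of_lt hij, ?_⟩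
    change τ^[j - i] (τ^[i] c) = τ^[i] c
    rw [← Function.iterate_add_apply, Nat.sub_add_cancel hij.le, h]
  intro i j h
  rcases lt_trichotomy i j with h' | h' | h'
  · exact absurd h (key i j h')
  · exact h'
  · exact absurd h.symm (key j i h')

theorem genOrbit.coe_map_iterate (n : ℕ) (x : genOrbit τ c) :
    ((genOrbit.map^[n] x : genOrbit τ c) : unitInterval) = τ^[n] x := by
  induction n generalizing x with
  | zero => rfl
  | succ n ih => rw [Function.iterate_succ_apply, ih]; rfl

/-- The sequence must start at 1 and absorb s_{τ0} among its early terms. If τ(0) = 0 this term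
vanishes and x is the orbit of 1. If τ(1) = 0, the orbit of c is c, 1, 0, τ(0), ...; dropping c and
0 gives 1, τ(0), τ²(0), ..., with s_{τ0} at index 1. -/
theorem IsUnimodal.exists_triangular_seq (h : IsUnimodal τ c) (hs : Function.Surjective τ)
    (hp : ¬ IsEventuallyPeriodic τ c) :
    ∃ x : ℕ → genOrbit τ c, x 0 = ⟨1, one_mem_genOrbit⟩ ∧ Function.Injective x ∧
      (∀ n, (x n : unitInterval) ≠ 0) ∧ ∀ n, ∃ ε : ℤ, (ε = 1 ∨ ε = -1) ∧
        h.transferMap (Disc.step (x n)) - ε • Disc.step (x (n + 1)) ∈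
          AddSubgroup.closure ((fun n => Disc.step (x n)) '' Iio (n + 1)) := by
  have hinj := injective_iterate_of_not_isEventuallyPeriodic hp
  have hc : τ c = 1 := h.map_crit hs
  rcases h.map_zero_or_map_one hs with hz | hz
  · let x : ℕ → genOrbit τ c := fun n => genOrbit.map^[n] ⟨1, one_mem_genOrbit⟩
    have hx : ∀ n, (x n : unitInterval) = τ^[n + 1] c := fun n => by
      rw [genOrbit.coe_map_iterate, Function.iterate_succ_apply, hc]
    refine ⟨x, rfl, fun i j hij => ?_, fun n hn => ?_,
      fun n => ?_⟩
    · have := congrArg Subtype.val hij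
      simp only [hx] at this
      simpa using hinj this
    · rw [hx] at hn
      -- An orbit reaching the fixed point 0 would make c eventually periodic.
      refine hp ⟨n + 1, 1, one_pos, ?_⟩
      rw [hn]
      exact hz
    · obtain ⟨ε, k, hε, he⟩ := h.transferMap_step hs (x n)
      have hsucc : x (n + 1) = genOrbit.map (x n) := Function.iterate_succ_apply' _ _ _
      refine ⟨ε, hε, ?_⟩
      rw [show genOrbit.map ⟨0, zero_mem_genOrbit⟩ = (⟨0, zero_mem_genOrbit⟩ : genOrbit τ c) from
        Subtype.ext hz, Disc.step_zero, sub_zero] at he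
      rw [he, hsucc, add_sub_cancel_left]
      have hmem : Disc.step (x 0) ∈
          AddSubgroup.closure ((fun n => Disc.step (x n)) '' Iio (n + 1)) :=
        AddSubgroup.subset_closure ⟨0, Nat.succ_pos n, rfl⟩
      exact AddSubgroup.zsmul_mem _ hmem k
  · have h0 : τ^[2] c = 0 := by rw [← hz, ← hc]; rfl
    let x : ℕ → genOrbit τ c
      | 0 => ⟨1, one_mem_genOrbit⟩
      | n + 1 => genOrbit.map^[n] (genOrbit.map ⟨0, zero_mem_genOrbit⟩)
    -- Each x_n is some τ^m(c), where m = 2 is excluded because τ²(c) = 0. Distinctness and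
    -- nonvanishing then follow from injectivity of the orbit of c.
    have hx : ∀ n, ∃ m, m ≠ 2 ∧ (x n : unitInterval) = τ^[m] c ∧ (n = 0 ∧ m = 1 ∨ m = n + 2) := by
      rintro (_ | n)
      · exact ⟨1, by simp, hc.symm, by simp⟩
      · refine ⟨n + 3, by omega, ?_, by omega⟩
        change ((genOrbit.map^[n] _ : genOrbit τ c) : unitInterval) = _
        rw [genOrbit.coe_map_iterate, show n + 3 = n + (1 + 2) from rfl,
          Function.iterate_add_apply τ n, Function.iterate_add_apply τ 1, h0]
        rfl
    refine ⟨x, rfl, fun i j hij => ?_, fun n hn => ?_, fun n => ?_⟩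
    · obtain ⟨m, hm, hm', hm''⟩ := hx i
      obtain ⟨l, hl, hl', hl''⟩ := hx j
      have := hinj (hm'.symm.trans ((congrArg Subtype.val hij).trans hl'))
      omega
    · obtain ⟨m, hm, hm', -⟩ := hx n
      exact hm (hinj (hm'.symm.trans (hn.trans h0.symm)))
    · have hmem : ∀ i, i < n + 1 → Disc.step (x i) ∈
          AddSubgroup.closure ((fun n => Disc.step (x n)) '' Iio (n + 1)) := fun i hi =>
        AddSubgroup.subset_closure ⟨i, hi, rfl⟩
      cases n with
      | zero =>
        -- The step from 1 to τ(0) does not follow τ: the new leading term is the correction -s_{τ0}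
        -- in L s_1 = 2 s_1 - s_{τ0}.
        refine ⟨-1, Or.inr rfl, ?_⟩
        have he := h.transferMap_step_right hs ⟨1, one_mem_genOrbit⟩ le_top
        rw [show genOrbit.map ⟨1, one_mem_genOrbit⟩ = (⟨0, zero_mem_genOrbit⟩ : genOrbit τ c) from
          Subtype.ext hz, Disc.step_zero, sub_zero] at he
        have : h.transferMap (Disc.step (x 0)) - (-1 : ℤ) • Disc.step (x (0 + 1)) =
            (2 : ℤ) • Disc.step (x 0) := by
          refine Eq.trans (congrArg (· - _) he) ?_
          rw [neg_one_zsmul, sub_neg_eq_add]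
          exact sub_add_cancel _ _
        rw [this]
        exact AddSubgroup.zsmul_mem _ (hmem 0 one_pos) 2
      | succ n =>
        obtain ⟨ε, k, hε, he⟩ := h.transferMap_step hs (x (n + 1))
        have hsucc : x (n + 1 + 1) = genOrbit.map (x (n + 1)) := Function.iterate_succ_apply' _ _ _
        refine ⟨ε, hε, ?_⟩
        rw [he, hsucc, add_sub_assoc, add_sub_cancel_left]
        exact AddSubgroup.sub_mem _ (AddSubgroup.zsmul_mem _ (hmem 0 (by omega)) k)
          (hmem 1 (by omega))

theorem laurentModule_toLaurent_smul {G : Type*} [AddCommGroup G] (e : G ≃+ G)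
    (q : Polynomial ℤ) (x : G) :
    letI := laurentModule e
    (Polynomial.toLaurent q : ℤ[T;T⁻¹]) • x = q.sum fun i z => z • e^[i] x := by
  let _ := laurentModule e
  conv_lhs => rw [← Polynomial.sum_monomial_eq q, Polynomial.sum, map_sum, Finset.sum_smul]
  refine Finset.sum_congr rfl fun i _ => ?_
  rw [Polynomial.toLaurent_C_mul_T, mul_smul, laurentModule_T_nat_smul, laurentModule_C_smul]

theorem DG.starAut_iterate_mk (h : IsUnimodal τ c) (hs : Function.Surjective τ) (n : ℕ)
    (f : C(DiscSpace τ c, ℤ)) :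
    (DimGroup.starAut (sigma τ c) h.isPiecewiseHomeo (h.sigma_surjective hs))^[n]
      (QuotientAddGroup.mk f : DG h) = QuotientAddGroup.mk (h.transferMap^[n] f) := by
  induction n generalizing f with
  | zero => rfl
  | succ n ih =>
    rw [Function.iterate_succ_apply, Function.iterate_succ_apply, ← ih]
    rfl

theorem DG.eq_zero_of_smul_interval_eq_zero (h : IsUnimodal τ c) (hs : Function.Surjective τ)
    (hp : ¬ IsEventuallyPeriodic τ c) :
    letI : Module ℤ[T;T⁻¹] (DG h) := DG.module h hs
    ∀ p : ℤ[T;T⁻¹],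
      p • DG.interval h 0 1 zero_mem_genOrbit one_mem_genOrbit zero_lt_one = 0 → p = 0 := by
  let _ : Module ℤ[T;T⁻¹] (DG h) := DG.module h hs
  intro p hpu
  obtain ⟨x, hx0, hxinj, hxne, hxL⟩ := h.exists_triangular_seq hs hp
  -- Multiplying by a power of T, a unit, turns p into an honest polynomial q.
  obtain ⟨n, q, hq⟩ := LaurentPolynomial.exists_T_pow p
  have hq0 : (Polynomial.toLaurent q : ℤ[T;T⁻¹]) •
      DG.interval h 0 1 zero_mem_genOrbit one_mem_genOrbit zero_lt_one = 0 := by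
    rw [hq, mul_comm, mul_smul, hpu, smul_zero]
  rw [DG.interval_zero_one, laurentModule_toLaurent_smul, ← hx0] at hq0
  have hmk : (QuotientAddGroup.mk (q.sum fun i z => z • h.transferMap^[i] (Disc.step (x 0))) :
      DG h) = 0 := by
    rw [← hq0]
    refine (map_sum (QuotientAddGroup.mk' (eventualKer (sigma τ c) h.isPiecewiseHomeo)) _ _).trans
      (Finset.sum_congr rfl fun i _ => ?_)
    exact congrArg (q.coeff i • ·) (DG.starAut_iterate_mk h hs i _).symm
  -- Vanishing in DG(τ) means vanishing after L^m; this only shifts all exponents by m.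
  obtain ⟨m, hm⟩ := (QuotientAddGroup.eq_zero_iff _).1 hmk
  have hm' : q.sum (fun i z => z • h.transferMap^[m + i] (Disc.step (x 0))) = 0 := by
    rw [← hm]
    refine Eq.trans (Finset.sum_congr rfl fun i _ => ?_)
      (map_sum (iterateHom h.transferMap m) _ _).symm
    rw [map_zsmul]
    exact congrArg (q.coeff i • ·) (Function.iterate_add_apply _ _ _ _)
  have hψ : ∀ n m, Disc.jump (x n) (Disc.step (x m)) = if n = m then 1 else 0 := by
    intro n m
    rw [Disc.jump_step (hxne n)]
    simp [hxinj.eq_iff]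
  have hdual : ∀ {m n : ℕ}, m ≤ n →
      (Disc.jump (x n) (h.transferMap^[m] (Disc.step (x 0))) = 0 ↔ m < n) :=
    fun {m n} hmn => dual_iterate (L := h.transferMap) (v := fun n => Disc.step (x n))
      (ψ := fun n => Disc.jump (x n)) hψ hxL hmn
  have hq' : q = 0 := by
    by_contra hne
    -- The jump at x_{m + deg q} sees only the top iterate, so it isolates the leading coefficient
    -- up to sign.
    have h1 := congrArg (Disc.jump (x (m + q.natDegree))) hm'
    rw [Polynomial.sum, map_sum, map_zero, Finset.sum_eq_single q.natDegree] at h1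
    · rw [map_zsmul, smul_eq_mul, mul_eq_zero] at h1
      rcases h1 with h1 | h1
      · exact hne (Polynomial.leadingCoeff_eq_zero.1 h1)
      · exact lt_irrefl _ ((hdual le_rfl).1 h1)
    · intro i hi hi'
      have hlt : i < q.natDegree := lt_of_le_of_ne (Polynomial.le_natDegree_of_mem_supp i hi) hi'
      rw [map_zsmul, (hdual (by omega)).2 (by omega), smul_zero]
    · intro hn
      rw [Polynomial.notMem_support_iff.1 hn, zero_smul, map_zero]
  rw [hq', map_zero] at hq
  exact (LaurentPolynomial.isUnit_T _).mul_left_eq_zero.1 hq.symm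

/-- If the critical point is not eventually periodic, the dimension module is free of rank one. -/
theorem DG.exists_addEquiv_laurent (h : IsUnimodal τ c) (hs : Function.Surjective τ)
    (hp : ¬ IsEventuallyPeriodic τ c) :
    ∃ Φ : DG h ≃+ ℤ[T;T⁻¹], ∀ x, Φ (DG.star h x) = LaurentPolynomial.T 1 * Φ x := by
  let _ : Module ℤ[T;T⁻¹] (DG h) := DG.module h hs
  let u := DG.interval h 0 1 zero_mem_genOrbit one_mem_genOrbit zero_lt_one
  let Ψ := LinearMap.toSpanSingleton ℤ[T;T⁻¹] (DG h) u
  have hbij : Function.Bijective Ψ := by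
    refine ⟨(injective_iff_map_eq_zero Ψ).2 (DG.eq_zero_of_smul_interval_eq_zero h hs hp), ?_⟩
    rw [← LinearMap.range_eq_top, LinearMap.range_toSpanSingleton]
    exact DG.span_interval h hs
  let E := LinearEquiv.ofBijective Ψ hbij
  refine ⟨E.symm.toAddEquiv, fun x => ?_⟩
  have : DG.star h x = (LaurentPolynomial.T 1 : ℤ[T;T⁻¹]) • x :=
    (laurentModule_T_smul (DimGroup.starAut (sigma τ c) h.isPiecewiseHomeo
      (h.sigma_surjective hs)) x).symm
  rw [this]
  exact map_smul E.symm _ x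

/-! ### Subdivisions and the existence of Markov partitions -/

section Subdivision

theorem Fin.exists_castSucc_and_not_succ {n : ℕ} {P : Fin (n + 1) → Prop} (h0 : P 0)
    (hl : ¬ P (Fin.last n)) : ∃ i : Fin n, P i.castSucc ∧ ¬ P i.succ := by
  by_contra! h
  exact hl (Fin.induction h0 (fun i hi => h i hi) (Fin.last n))

variable {n : ℕ} {b : Fin (n + 1) → unitInterval}

theorem exists_mem_Ico_subdivision (h0 : b 0 = 0) (hl : b (Fin.last n) = 1) {x : unitInterval}
    (hx : x < 1) : ∃ i : Fin n, x ∈ Ico (b i.castSucc) (b i.succ) := by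
  obtain ⟨i, hi, hi'⟩ := Fin.exists_castSucc_and_not_succ (P := fun k => b k ≤ x)
    (h0 ▸ bot_le) (by rw [hl]; exact not_le.2 hx)
  exact ⟨i, hi, not_le.1 hi'⟩

theorem exists_mem_Ioc_subdivision (h0 : b 0 = 0) (hl : b (Fin.last n) = 1) {x : unitInterval}
    (hx : 0 < x) : ∃ i : Fin n, x ∈ Ioc (b i.castSucc) (b i.succ) := by
  obtain ⟨i, hi, hi'⟩ := Fin.exists_castSucc_and_not_succ (P := fun k => b k < x)
    (h0 ▸ hx) (by rw [hl]; exact not_lt.2 le_top)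
  exact ⟨i, hi, not_lt.1 hi'⟩

theorem le_castSucc_or_succ_le (hb : StrictMono b) {x : unitInterval} (hx : x ∈ range b)
    (i : Fin n) : x ≤ b i.castSucc ∨ b i.succ ≤ x := by
  obtain ⟨k, rfl⟩ := hx
  rw [hb.le_iff_le, hb.le_iff_le]
  exact (le_or_gt k i.castSucc).imp_right fun h => Fin.castSucc_lt_iff_succ_le.1 h

theorem Icc_eq_iUnion_subdivision (hb : StrictMono b) (h0 : b 0 = 0) (hl : b (Fin.last n) = 1)
    {u v : unitInterval} (hu : u ∈ range b) (hv : v ∈ range b) (huv : u < v) :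
    ∃ J : Set (Fin n), Icc u v = ⋃ j ∈ J, Icc (b j.castSucc) (b j.succ) := by
  refine ⟨{j | u ≤ b j.castSucc ∧ b j.succ ≤ v}, Subset.antisymm ?_ ?_⟩
  · rintro x ⟨hux, hxv⟩
    -- The chosen piece must overlap the interior of [u, v], so x is taken in a piece open on the
    -- right if x < v and open on the left if x = v.
    have key : ∃ i : Fin n, x ∈ Icc (b i.castSucc) (b i.succ) ∧ b i.castSucc < v ∧
        u < b i.succ := by
      rcases hxv.lt_or_eq with h | rfl
      · obtain ⟨i, h1, h2⟩ := exists_mem_Ico_subdivision h0 hl (h.trans_le le_top)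
        exact ⟨i, ⟨h1, h2.le⟩, h1.trans_lt h, hux.trans_lt h2⟩
      · obtain ⟨i, h1, h2⟩ := exists_mem_Ioc_subdivision h0 hl (lt_of_le_of_lt bot_le huv)
        exact ⟨i, ⟨h1.le, h2⟩, h1, huv.trans_le h2⟩
    obtain ⟨i, hx, h1, h2⟩ := key
    simp only [mem_iUnion]
    exact ⟨i, ⟨(le_castSucc_or_succ_le hb hu i).resolve_right (not_le.2 h2),
      (le_castSucc_or_succ_le hb hv i).resolve_left (not_le.2 h1)⟩, hx⟩
  · simp only [iUnion_subset_iff]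
    rintro j ⟨h1, h2⟩
    exact Icc_subset_Icc h1 h2

end Subdivision

variable {τ : unitInterval → unitInterval} {c : unitInterval}

theorem IsUnimodal.monotoneOn_or_antitoneOn (h : IsUnimodal τ c) {u v : unitInterval}
    (huv : v ≤ c ∨ c ≤ u) : MonotoneOn τ (Icc u v) ∨ AntitoneOn τ (Icc u v) := by
  rcases huv with hv | hu
  · exact Or.inl (h.strictMonoOn.monotoneOn.mono (Icc_subset_Icc bot_le hv))
  · exact Or.inr (h.strictAntiOn.antitoneOn.mono (Icc_subset_Icc hu le_top))

theorem IsUnimodal.closure_image_Ioo (h : IsUnimodal τ c) {u v : unitInterval} (huv : u < v) :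
    closure (τ '' Ioo u v) = τ '' Icc u v := by
  rw [← closure_Ioo huv.ne]
  refine (image_closure_of_isCompact ?_ h.continuous.continuousOn).symm
  exact isClosed_closure.isCompact

theorem finite_range_iterate (hp : IsEventuallyPeriodic τ c) :
    (range fun n => τ^[n] c).Finite := by
  obtain ⟨k, m, hm, hk⟩ := hp
  have hk' : τ^[m + k] c = τ^[k] c := by
    rw [Function.iterate_add_apply]
    exact hk
  refine ((Finset.range (m + k)).finite_toSet.image fun n => τ^[n] c).subset ?_
  rintro _ ⟨n, rfl⟩
  induction n using Nat.strong_induction_on with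
  | _ n ih =>
    by_cases hn : n < m + k
    · exact ⟨n, by simpa using hn, rfl⟩
    -- Beyond the preperiod, exponents can be lowered by the period m.
    · have e : τ^[n] c = τ^[n - m] c := by
        obtain ⟨l, rfl⟩ := Nat.exists_eq_add_of_le (not_lt.1 hn)
        rw [show m + k + l = l + (m + k) by omega, show l + (m + k) - m = l + k by omega,
          Function.iterate_add_apply, hk', ← Function.iterate_add_apply]
      have := ih (n - m) (by omega)
      simpa only [e] using this

/-- A finite forward invariant set between `{0, c, 1}` and the generalized orbit is the set of points
of a Markov partition. -/
theorem IsUnimodal.isMarkov_of_finite (h : IsUnimodal τ c) {B : Set unitInterval} (hB : B.Finite)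
    (hC : partitionPts c ⊆ B) (hBo : B ⊆ genOrbit τ c) (hτB : MapsTo τ B B) :
    IsMarkov τ c := by
  obtain ⟨s, rfl⟩ := hB.exists_finset_coe
  have h0s : (0 : unitInterval) ∈ s := hC (by simp [partitionPts])
  have h1s : (1 : unitInterval) ∈ s := hC (by simp [partitionPts])
  have hcs : c ∈ s := hC (by simp [partitionPts])
  obtain ⟨n, hn⟩ : ∃ n, s.card = n + 1 :=
    ⟨s.card - 1, (Nat.succ_pred_eq_of_pos (Finset.card_pos.2 ⟨0, h0s⟩)).symm⟩
  let b : Fin (n + 1) → unitInterval := s.orderEmbOfFin hn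
  have hb : StrictMono b := (s.orderEmbOfFin hn).strictMono
  have hr : range b = s := s.range_orderEmbOfFin hn
  have hb0 : b 0 = 0 := by
    obtain ⟨i, hi⟩ : (0 : unitInterval) ∈ range b := hr ▸ h0s
    exact le_antisymm (hi ▸ hb.monotone (Fin.zero_le i)) bot_le
  have hb1 : b (Fin.last n) = 1 := by
    obtain ⟨i, hi⟩ : (1 : unitInterval) ∈ range b := hr ▸ h1s
    exact le_antisymm le_top (hi ▸ hb.monotone (Fin.le_last i))
  have hmem : ∀ i, b i ∈ s := fun i => s.orderEmbOfFin_mem hn i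
  have hside : ∀ i : Fin n, b i.succ ≤ c ∨ c ≤ b i.castSucc := fun i =>
    (le_castSucc_or_succ_le hb (hr ▸ hcs : c ∈ range b) i).symm
  have hlt : ∀ i : Fin n, b i.castSucc < b i.succ := fun i => hb Fin.castSucc_lt_succ
  -- The exponent 0 suffices in the last condition, since B itself contains {0, c, 1}.
  refine ⟨n, b, hb, hb0, hb1, fun i => hBo (hmem i), fun i => ?_, fun i => ?_, 0, ?_⟩
  · exact (h.monotoneOn_or_antitoneOn (hside i)).imp (fun h' => h'.mono Ioo_subset_Icc_self)
      fun h' => h'.mono Ioo_subset_Icc_self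
  · rw [h.closure_image_Ioo (hlt i)]
    have hr1 : τ (b i.castSucc) ∈ range b := hr ▸ hτB (hmem _)
    have hr2 : τ (b i.succ) ∈ range b := hr ▸ hτB (hmem _)
    rcases hside i with hi | hi
    · have hm : MonotoneOn τ (Icc (b i.castSucc) (b i.succ)) :=
        h.strictMonoOn.monotoneOn.mono (Icc_subset_Icc bot_le hi)
      rw [Subset.antisymm hm.image_Icc_subset
        (intermediate_value_Icc (hlt i).le h.continuous.continuousOn)]
      exact Icc_eq_iUnion_subdivision hb hb0 hb1 hr1 hr2
        (h.strictMonoOn ⟨bot_le, (hlt i).le.trans hi⟩ ⟨bot_le, hi⟩ (hlt i))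
    · have hm : AntitoneOn τ (Icc (b i.castSucc) (b i.succ)) :=
        h.strictAntiOn.antitoneOn.mono (Icc_subset_Icc hi le_top)
      rw [Subset.antisymm hm.image_Icc_subset
        (intermediate_value_Icc' (hlt i).le h.continuous.continuousOn)]
      exact Icc_eq_iUnion_subdivision hb hb0 hb1 hr2 hr1
        (h.strictAntiOn ⟨hi, le_top⟩ ⟨hi.trans (hlt i).le, le_top⟩ (hlt i))
  · rw [hr]
    simpa using hC

/-- If the critical point of a surjective unimodal map is eventually periodic, the map is Markov. -/
theorem IsUnimodal.isMarkov (h : IsUnimodal τ c) (hs : Function.Surjective τ)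
    (hp : IsEventuallyPeriodic τ c) : IsMarkov τ c := by
  have hc1 : τ c = 1 := h.map_crit hs
  have hmap : ∀ n, τ (τ^[n] c) = τ^[n + 1] c := fun n => (Function.iterate_succ_apply' τ n c).symm
  refine h.isMarkov_of_finite (B := insert 0 (range fun n => τ^[n] c))
    ((finite_range_iterate hp).insert 0) ?_ ?_ ?_
  · rintro x (rfl | rfl | rfl)
    · exact Or.inl rfl
    · exact Or.inr ⟨0, rfl⟩
    · exact Or.inr ⟨1, hc1⟩
  · rintro x (rfl | ⟨n, rfl⟩)
    · exact zero_mem_genOrbit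
    · induction n with
      | zero => exact crit_mem_genOrbit
      | succ n ih =>
        simp only [← hmap]
        exact map_mem_genOrbit_iff.2 ih
  · rintro x (rfl | ⟨n, rfl⟩)
    · rcases h.map_zero_or_map_one hs with hz | hz
      · exact Or.inl hz
      -- The orbit runs c, 1, 0, τ(0), so τ(0) = τ³(c).
      · refine Or.inr ⟨3, ?_⟩
        simp only [← hmap, Function.iterate_zero, id, hc1, hz]
    · exact Or.inr ⟨n + 1, (hmap n).symm⟩

/-! ### Markov partitions contain c and are forward invariant -/

section MarkovPartition

variable {n : ℕ} {b : Fin (n + 1) → unitInterval}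

theorem IsMarkovPartition.zero_mem_range (hb : IsMarkovPartition τ c b) : 0 ∈ range b :=
  ⟨0, hb.first⟩

theorem IsMarkovPartition.one_mem_range (hb : IsMarkovPartition τ c b) : 1 ∈ range b :=
  ⟨Fin.last n, hb.last⟩

theorem IsMarkovPartition.castSucc_lt_succ (hb : IsMarkovPartition τ c b) (i : Fin n) :
    b i.castSucc < b i.succ :=
  hb.strictMono Fin.castSucc_lt_succ

/-- Otherwise c is interior to a piece on which τ is monotonic, contradicting the strict maximum at
c from one side or the other. -/
theorem IsMarkovPartition.crit_mem_range (hb : IsMarkovPartition τ c b) (h : IsUnimodal τ c) :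
    c ∈ range b := by
  by_contra hc
  obtain ⟨i, hi, hi'⟩ := exists_mem_Ico_subdivision hb.first hb.last h.lt_one
  have hi : b i.castSucc < c := lt_of_le_of_ne hi fun h' => hc ⟨_, h'⟩
  rcases hb.monotone i with hm | hm
  · obtain ⟨y, hy, hy'⟩ := exists_between hi'
    exact not_le.2 (h.lt_max_right hy) (hm ⟨hi, hi'⟩ ⟨hi.trans hy, hy'⟩ hy.le)
  · obtain ⟨y, hy, hy'⟩ := exists_between hi
    exact not_le.2 (h.lt_max_left hy') (hm ⟨hy, hy'.trans hi'⟩ ⟨hi, hi'⟩ hy'.le)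

theorem IsMarkovPartition.succ_le_crit_or (hb : IsMarkovPartition τ c b) (h : IsUnimodal τ c)
    (i : Fin n) : b i.succ ≤ c ∨ c ≤ b i.castSucc :=
  (le_castSucc_or_succ_le hb.strictMono (hb.crit_mem_range h) i).symm

theorem mem_range_of_isLeast_or_isGreatest {J : Set (Fin n)} {z : unitInterval}
    (hb : StrictMono b)
    (hz : IsLeast (⋃ j ∈ J, Icc (b j.castSucc) (b j.succ)) z ∨
      IsGreatest (⋃ j ∈ J, Icc (b j.castSucc) (b j.succ)) z) : z ∈ range b := by
  have hlt : ∀ i : Fin n, b i.castSucc ≤ b i.succ := fun i => (hb Fin.castSucc_lt_succ).le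
  rcases hz with ⟨hz, hz'⟩ | ⟨hz, hz'⟩ <;> obtain ⟨j, hj, hzj⟩ := mem_iUnion₂.1 hz
  · exact ⟨_, le_antisymm hzj.1 (hz' (mem_iUnion₂.2 ⟨j, hj, le_rfl, hlt j⟩))⟩
  · exact ⟨_, le_antisymm (hz' (mem_iUnion₂.2 ⟨j, hj, hlt j, le_rfl⟩)) hzj.2⟩

/-- The closure of the image of an open piece is the image of the closed piece. By monotonicity its
extremes are the values of τ at the end points, and the extremes of a union of pieces are partition
points. -/
theorem IsMarkovPartition.map_mem_range (hb : IsMarkovPartition τ c b) (h : IsUnimodal τ c)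
    {x : unitInterval} (hx : x ∈ range b) : τ x ∈ range b := by
  have key : ∀ i : Fin n, τ (b i.castSucc) ∈ range b ∧ τ (b i.succ) ∈ range b := by
    intro i
    obtain ⟨J, hJ⟩ := hb.closure_image i
    have hle := (hb.castSucc_lt_succ i).le
    rw [h.closure_image_Ioo (hb.castSucc_lt_succ i)] at hJ
    rcases h.monotoneOn_or_antitoneOn (hb.succ_le_crit_or h i) with hm | hm
    · exact ⟨mem_range_of_isLeast_or_isGreatest hb.strictMono
          (Or.inl (hJ ▸ hm.map_isLeast (isLeast_Icc hle))),
        mem_range_of_isLeast_or_isGreatest hb.strictMono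
          (Or.inr (hJ ▸ hm.map_isGreatest (isGreatest_Icc hle)))⟩
    · exact ⟨mem_range_of_isLeast_or_isGreatest hb.strictMono
          (Or.inr (hJ ▸ hm.map_isLeast (isLeast_Icc hle))),
        mem_range_of_isLeast_or_isGreatest hb.strictMono
          (Or.inl (hJ ▸ hm.map_isGreatest (isGreatest_Icc hle)))⟩
  obtain ⟨k, rfl⟩ := hx
  cases k using Fin.cases with
  | succ i => exact (key i).2
  | zero =>
    obtain ⟨i, hi, -⟩ := exists_mem_Ico_subdivision hb.first hb.last zero_lt_one
    have : b i.castSucc = b 0 := by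
      rw [hb.first]
      exact le_antisymm hi bot_le
    rw [← this]
    exact (key i).1

end MarkovPartition

/-! ### Positive preimages under the transfer map -/

section Positive

variable {X : Type*} [TopologicalSpace X] [CompactSpace X] [T2Space X]

/-- On a clopen set mapped bijectively onto X, pull f back by σ and extend by 0; this keeps signs.
-/
theorem exists_nonneg_transferHom_eq {σ : X → X} (h : IsPiecewiseHomeo σ) {P : Set X}
    (hP : IsClopen P) (hinj : InjOn σ P) (hsurj : σ '' P = univ) (f : C(X, ℤ)) :
    ∃ g, transferHom σ h g = f ∧ (0 ≤ f → 0 ≤ g) := by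
  refine ⟨⟨P.indicator fun y => f (σ y), (f.continuous.comp h.continuous).indicator
    (by simp [hP.frontier_eq])⟩, ?_, fun hf x => ?_⟩
  · ext x
    obtain ⟨y, hy, rfl⟩ : x ∈ σ '' P := hsurj ▸ mem_univ x
    have h0 : ∀ z ∉ P, P.indicator (fun y => f (σ y)) z = 0 := fun z hz => indicator_of_notMem hz _
    exact (transfer_apply_of_injOn hinj h0 hy).trans (indicator_of_mem hy _)
  · exact indicator_nonneg (fun y _ => hf (σ y)) x

theorem transferHom_nonneg {σ : X → X} (h : IsPiecewiseHomeo σ) {f : C(X, ℤ)} (hf : 0 ≤ f) :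
    0 ≤ transferHom σ h f := fun _ =>
  finsum_nonneg fun y => finsum_nonneg fun _ => hf y

end Positive

variable {τ : unitInterval → unitInterval} {c : unitInterval}

/-- One branch is onto X: the increasing one if τ(0) = 0, the decreasing one if τ(1) = 0. -/
theorem IsUnimodal.exists_nonneg_transferMap_eq (h : IsUnimodal τ c)
    (hs : Function.Surjective τ) (f : C(DiscSpace τ c, ℤ)) :
    ∃ g, h.transferMap g = f ∧ (0 ≤ f → 0 ≤ g) := by
  have hfull : Icc (Disc.upper (genOrbit τ c) 0) (Disc.lower _ 1) = univ :=
    eq_univ_of_forall fun q => ⟨Disc.upper_zero_eq (S := genOrbit τ c) ▸ Disc.lower_zero_le q,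
      Disc.le_lower_one q⟩
  rcases h.map_zero_or_map_one hs with hz | hz
  · refine exists_nonneg_transferHom_eq h.isPiecewiseHomeo
      ⟨isClosed_Iic, Disc.isOpen_Iic_lower crit_mem_genOrbit h.pos.ne'⟩
      h.strictMono_sigma.injOn ?_ f
    rw [h.image_left, hz, h.map_crit hs, hfull]
  · refine exists_nonneg_transferHom_eq h.isPiecewiseHomeo
      ⟨isClosed_Ici, Disc.isOpen_Ici_upper crit_mem_genOrbit h.lt_one.ne⟩
      h.strictAnti_sigma.injOn ?_ f
    rw [h.image_right, hz, h.map_crit hs, hfull]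

theorem IsUnimodal.exists_nonneg_iterate_eq (h : IsUnimodal τ c)
    (hs : Function.Surjective τ) (n : ℕ) (f : C(DiscSpace τ c, ℤ)) :
    ∃ g, h.transferMap^[n] g = f ∧ (0 ≤ f → 0 ≤ g) := by
  induction n generalizing f with
  | zero => exact ⟨f, rfl, id⟩
  | succ n ih =>
    obtain ⟨g, rfl, hg⟩ := ih f
    obtain ⟨k, rfl, hk⟩ := h.exists_nonneg_transferMap_eq hs g
    exact ⟨k, rfl, fun hf => hk (hg hf)⟩

theorem IsUnimodal.iterate_nonneg (h : IsUnimodal τ c) {f : C(DiscSpace τ c, ℤ)} (hf : 0 ≤ f)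
    (n : ℕ) : 0 ≤ h.transferMap^[n] f := by
  induction n with
  | zero => exact hf
  | succ n ih =>
    rw [Function.iterate_succ_apply']
    exact transferHom_nonneg _ ih

/-! ### The span of the step functions at a forward invariant set -/

/-- The functions spanned by the characteristic functions of `[0⁺, x⁻]` for `x` in `B`. -/
noncomputable def stepSpan (τ : unitInterval → unitInterval) (c : unitInterval)
    (B : Set unitInterval) : AddSubgroup C(DiscSpace τ c, ℤ) :=
  AddSubgroup.closure (Disc.step '' {x | (x : unitInterval) ∈ B})

theorem step_mem_stepSpan {B : Set unitInterval} {x : genOrbit τ c} (hx : (x : unitInterval) ∈ B) :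
    Disc.step x ∈ stepSpan τ c B :=
  AddSubgroup.subset_closure ⟨x, hx, rfl⟩

theorem IsUnimodal.transferMap_mem_stepSpan (h : IsUnimodal τ c) (hs : Function.Surjective τ)
    {B : Set unitInterval} (hB : MapsTo τ B B) (h0 : 0 ∈ B) (h1 : 1 ∈ B)
    {f : C(DiscSpace τ c, ℤ)} (hf : f ∈ stepSpan τ c B) : h.transferMap f ∈ stepSpan τ c B := by
  have : stepSpan τ c B ≤ (stepSpan τ c B).comap h.transferMap := by
    refine (AddSubgroup.closure_le _).2 ?_
    rintro _ ⟨x, hx, rfl⟩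
    obtain ⟨ε, k, -, he⟩ := h.transferMap_step hs x
    rw [SetLike.mem_coe, AddSubgroup.mem_comap, he]
    refine sub_mem (add_mem (zsmul_mem (step_mem_stepSpan (hB hx)) _)
      (zsmul_mem (step_mem_stepSpan h1) _)) (step_mem_stepSpan (hB h0))
  exact this hf

theorem IsUnimodal.iterate_mem_stepSpan (h : IsUnimodal τ c) (hs : Function.Surjective τ)
    {B : Set unitInterval} (hB : MapsTo τ B B) (h0 : 0 ∈ B) (h1 : 1 ∈ B)
    {f : C(DiscSpace τ c, ℤ)} {m n : ℕ} (hmn : m ≤ n) (hf : h.transferMap^[m] f ∈ stepSpan τ c B) :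
    h.transferMap^[n] f ∈ stepSpan τ c B := by
  induction n, hmn using Nat.le_induction with
  | base => exact hf
  | succ n _ ih =>
    rw [Function.iterate_succ_apply']
    exact h.transferMap_mem_stepSpan hs hB h0 h1 ih

/-- The functions that eventually enter the span form a subgroup containing s_1. It is insensitive
to applying L, because the span is L-invariant, so the generation principle applies. -/
theorem IsUnimodal.exists_iterate_mem_stepSpan (h : IsUnimodal τ c) (hs : Function.Surjective τ)
    {B : Set unitInterval} (hB : MapsTo τ B B) (h0 : 0 ∈ B) (h1 : 1 ∈ B)
    (f : C(DiscSpace τ c, ℤ)) : ∃ n, h.transferMap^[n] f ∈ stepSpan τ c B := by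
  let N : AddSubgroup C(DiscSpace τ c, ℤ) :=
    { carrier := {f | ∃ n, h.transferMap^[n] f ∈ stepSpan τ c B}
      zero_mem' := ⟨0, zero_mem _⟩
      add_mem' := by
        rintro f g ⟨n, hn⟩ ⟨m, hm⟩
        refine ⟨max n m, ?_⟩
        rw [iterate_map_add]
        exact add_mem (h.iterate_mem_stepSpan hs hB h0 h1 (le_max_left n m) hn)
          (h.iterate_mem_stepSpan hs hB h0 h1 (le_max_right n m) hm)
      neg_mem' := by
        rintro f ⟨n, hn⟩
        refine ⟨n, ?_⟩
        rw [iterate_map_neg]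
        exact neg_mem hn }
  refine h.mem_of_transferMap_mem_iff hs (N := N) (fun g => ⟨?_, ?_⟩) ⟨0, step_mem_stepSpan h1⟩ f
  · rintro ⟨n, hn⟩
    exact ⟨n + 1, hn⟩
  · rintro ⟨n, hn⟩
    refine ⟨n, ?_⟩
    rw [← Function.iterate_succ_apply]
    exact h.iterate_mem_stepSpan hs hB h0 h1 n.le_succ hn

/-! ### The limit group of the incidence matrix -/

namespace IsMarkovPartition

variable {n : ℕ} {b : Fin (n + 1) → unitInterval}

theorem mapsTo_range (hb : IsMarkovPartition τ c b) (h : IsUnimodal τ c) :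
    MapsTo τ (range b) (range b) := fun _ hx => hb.map_mem_range h hx

theorem markovPiece_eq (hb : IsMarkovPartition τ c b) (i : Fin n) :
    markovPiece τ c b i = Disc.below _ (b i.succ) \ Disc.below _ (b i.castSucc) :=
  Disc.Icc_eq_below_diff (hb.mem_genOrbit _) (hb.castSucc_lt_succ i)

/-- The left end point of a set of the partition. -/
noncomputable def leftEnd (τ : unitInterval → unitInterval) (c : unitInterval)
    (b : Fin (n + 1) → unitInterval) (i : Fin n) : DiscSpace τ c := Disc.upper _ (b i.castSucc)

theorem leftEnd_mem (hb : IsMarkovPartition τ c b) (i : Fin n) :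
    leftEnd τ c b i ∈ markovPiece τ c b i :=
  ⟨le_rfl, (Disc.lt_lower_iff.2 (by simpa [leftEnd] using hb.castSucc_lt_succ i)).le⟩

theorem exists_mem_markovPiece (hb : IsMarkovPartition τ c b) (p : DiscSpace τ c) :
    ∃ i, p ∈ markovPiece τ c b i := by
  obtain ⟨i, hi, hi'⟩ := Fin.exists_castSucc_and_not_succ
    (P := fun k => p ∉ Disc.below (genOrbit τ c) (b k)) (by simp [hb.first, Disc.below_zero])
    (by simp [hb.last, Disc.below_one])
  exact ⟨i, hb.markovPiece_eq i ▸ ⟨not_not.1 hi', hi⟩⟩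

theorem mem_markovPiece_iff (hb : IsMarkovPartition τ c b) {i j : Fin n} {p : DiscSpace τ c}
    (hp : p ∈ markovPiece τ c b j) : p ∈ markovPiece τ c b i ↔ i = j := by
  refine ⟨fun hp' => ?_, fun h => h ▸ hp⟩
  rw [hb.markovPiece_eq] at hp hp'
  rcases lt_trichotomy i j with hij | hij | hij
  · exact absurd (Disc.below_mono (hb.strictMono.monotone (Fin.le_castSucc_iff.2
      (Fin.succ_lt_succ_iff.2 hij))) hp'.1) hp.2
  · exact hij
  · exact absurd (Disc.below_mono (hb.strictMono.monotone (Fin.le_castSucc_iff.2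
      (Fin.succ_lt_succ_iff.2 hij))) hp.1) hp'.2

/-- Partition points do not cut pieces, so each generating step function is constant on every piece.
-/
theorem apply_eq_of_mem_stepSpan (hb : IsMarkovPartition τ c b) {f : C(DiscSpace τ c, ℤ)}
    (hf : f ∈ stepSpan τ c (range b)) {j : Fin n} {p : DiscSpace τ c}
    (hp : p ∈ markovPiece τ c b j) : f p = f (leftEnd τ c b j) := by
  have hq := hb.leftEnd_mem j
  rw [hb.markovPiece_eq] at hp hq
  induction hf using AddSubgroup.closure_induction with
  | mem f hf =>
    obtain ⟨x, hx, rfl⟩ := hf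
    rcases le_castSucc_or_succ_le hb.strictMono hx j with h | h
    · rw [Disc.step_apply_of_notMem fun h' => hp.2 (Disc.below_mono h h'),
        Disc.step_apply_of_notMem fun h' => hq.2 (Disc.below_mono h h')]
    · rw [Disc.step_apply_of_mem (Disc.below_mono h hp.1),
        Disc.step_apply_of_mem (Disc.below_mono h hq.1)]
  | zero => rfl
  | add f g _ _ hf hg => rw [ContinuousMap.add_apply, ContinuousMap.add_apply, hf, hg]
  | neg f _ hf => rw [ContinuousMap.neg_apply, ContinuousMap.neg_apply, hf]

/-- The values of a function at the left end points of the sets of the partition. -/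
noncomputable def coords (τ : unitInterval → unitInterval) (c : unitInterval)
    (b : Fin (n + 1) → unitInterval) : C(DiscSpace τ c, ℤ) →+ (Fin n → ℤ) :=
  AddMonoidHom.mk' (fun f i => f (leftEnd τ c b i)) fun _ _ => rfl

theorem coords_apply (f : C(DiscSpace τ c, ℤ)) (i : Fin n) :
    coords τ c b f i = f (leftEnd τ c b i) := rfl

/-- The characteristic function of a set of the partition. -/
noncomputable def pieceFun (hb : IsMarkovPartition τ c b) (i : Fin n) : C(DiscSpace τ c, ℤ) :=
  Disc.step ⟨b i.succ, hb.mem_genOrbit _⟩ - Disc.step ⟨b i.castSucc, hb.mem_genOrbit _⟩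

theorem coe_pieceFun (hb : IsMarkovPartition τ c b) (i : Fin n) :
    ⇑(hb.pieceFun i) = (markovPiece τ c b i).indicator fun _ => (1 : ℤ) := by
  rw [hb.markovPiece_eq]
  exact Disc.step_sub_step (hb.castSucc_lt_succ i).le

theorem pieceFun_mem (hb : IsMarkovPartition τ c b) (i : Fin n) :
    hb.pieceFun i ∈ stepSpan τ c (range b) :=
  sub_mem (step_mem_stepSpan (mem_range_self _)) (step_mem_stepSpan (mem_range_self _))

theorem sum_smul_pieceFun_apply (hb : IsMarkovPartition τ c b) (v : Fin n → ℤ) {j : Fin n}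
    {p : DiscSpace τ c} (hp : p ∈ markovPiece τ c b j) :
    (∑ i, v i • hb.pieceFun i) p = v j := by
  rw [ContinuousMap.sum_apply, Finset.sum_eq_single j]
  · rw [ContinuousMap.smul_apply, hb.coe_pieceFun, indicator_of_mem hp, smul_eq_mul, mul_one]
  · intro i _ hij
    rw [ContinuousMap.smul_apply, hb.coe_pieceFun,
      indicator_of_notMem (fun h => hij ((hb.mem_markovPiece_iff hp).1 h)), smul_zero]
  · simp

theorem coords_sum_smul_pieceFun (hb : IsMarkovPartition τ c b) (v : Fin n → ℤ) :
    coords τ c b (∑ i, v i • hb.pieceFun i) = v := by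
  funext j
  exact hb.sum_smul_pieceFun_apply v (hb.leftEnd_mem j)

theorem sum_smul_pieceFun_coords (hb : IsMarkovPartition τ c b) {f : C(DiscSpace τ c, ℤ)}
    (hf : f ∈ stepSpan τ c (range b)) : ∑ i, coords τ c b f i • hb.pieceFun i = f := by
  ext p
  obtain ⟨j, hj⟩ := hb.exists_mem_markovPiece p
  rw [hb.sum_smul_pieceFun_apply _ hj, hb.apply_eq_of_mem_stepSpan hf hj, coords_apply]

theorem injOn_sigma (hb : IsMarkovPartition τ c b) (h : IsUnimodal τ c) (i : Fin n) :
    InjOn (sigma τ c) (markovPiece τ c b i) := by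
  rw [hb.markovPiece_eq]
  rcases hb.succ_le_crit_or h i with hi | hi
  · refine h.strictMono_sigma.injOn.mono fun p hp => ?_
    rw [← Disc.below_eq_Iic h.pos.ne']
    exact Disc.below_mono hi hp.1
  · refine h.strictAnti_sigma.injOn.mono fun p hp => ?_
    rw [← Disc.compl_below crit_mem_genOrbit h.lt_one.ne]
    exact fun h' => hp.2 (Disc.below_mono hi h')

theorem coords_transferMap_pieceFun (hb : IsMarkovPartition τ c b) (h : IsUnimodal τ c)
    (hs : Function.Surjective τ) (i j : Fin n) :
    coords τ c b (h.transferMap (hb.pieceFun i)) j = incidenceMatrix τ c b i j := by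
  classical
  have hcoe : ⇑(h.transferMap (hb.pieceFun i)) =
      (sigma τ c '' markovPiece τ c b i).indicator fun _ => (1 : ℤ) := by
    rw [h.coe_transferMap, hb.coe_pieceFun, transfer_indicator_one (hb.injOn_sigma h i)]
  have hmem := h.transferMap_mem_stepSpan hs (hb.mapsTo_range h) hb.zero_mem_range
    hb.one_mem_range (hb.pieceFun_mem i)
  -- The characteristic function of σ(E_i) lies in the span, hence is constant on E_j; containing
  -- E_j can be tested at one point.
  have hiff : markovPiece τ c b j ⊆ sigma τ c '' markovPiece τ c b i ↔
      leftEnd τ c b j ∈ sigma τ c '' markovPiece τ c b i := by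
    refine ⟨fun h' => h' (hb.leftEnd_mem j), fun h' p hp => ?_⟩
    have := hb.apply_eq_of_mem_stepSpan hmem hp
    rw [hcoe, indicator_of_mem h'] at this
    by_contra hp'
    rw [indicator_of_notMem hp'] at this
    exact zero_ne_one this
  rw [coords_apply, hcoe, incidenceMatrix, Matrix.of_apply, indicator_apply]
  simp only [hiff]

theorem coords_transferMap (hb : IsMarkovPartition τ c b) (h : IsUnimodal τ c)
    (hs : Function.Surjective τ) {f : C(DiscSpace τ c, ℤ)} (hf : f ∈ stepSpan τ c (range b)) :
    coords τ c b (h.transferMap f) = rightMul (incidenceMatrix τ c b) (coords τ c b f) := by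
  conv_lhs => rw [← hb.sum_smul_pieceFun_coords hf]
  funext j
  rw [map_sum, map_sum, Finset.sum_apply]
  change _ = Matrix.vecMul (coords τ c b f) (incidenceMatrix τ c b) j
  rw [Matrix.vecMul, dotProduct]
  refine Finset.sum_congr rfl fun i _ => ?_
  rw [map_zsmul, map_zsmul, Pi.smul_apply, hb.coords_transferMap_pieceFun h hs, smul_eq_mul]

theorem eventually_iterate_mem (hb : IsMarkovPartition τ c b) (h : IsUnimodal τ c)
    (hs : Function.Surjective τ) (f : C(DiscSpace τ c, ℤ)) :
    ∀ᶠ k in atTop, h.transferMap^[k] f ∈ stepSpan τ c (range b) := by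
  obtain ⟨m, hm⟩ := h.exists_iterate_mem_stepSpan hs (hb.mapsTo_range h) hb.zero_mem_range
    hb.one_mem_range f
  filter_upwards [eventually_ge_atTop m] with k hk
  exact h.iterate_mem_stepSpan hs (hb.mapsTo_range h) hb.zero_mem_range hb.one_mem_range hk hm

/-- The coordinates of the iterates of a function under the transfer map, as an element of the limit
group of the incidence matrix. -/
noncomputable def toLimit (hb : IsMarkovPartition τ c b) (h : IsUnimodal τ c)
    (hs : Function.Surjective τ) :
    C(DiscSpace τ c, ℤ) →+ MatrixDimGroup (incidenceMatrix τ c b) :=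
  (QuotientAddGroup.mk' _).comp (AddMonoidHom.mk' (fun f =>
    (⟨fun k => coords τ c b (h.transferMap^[k] f), by
      filter_upwards [hb.eventually_iterate_mem h hs f] with k hk
      rw [Function.iterate_succ_apply']
      exact (hb.coords_transferMap h hs hk).symm⟩ :
      eventuallyCompatible (rightMul (incidenceMatrix τ c b)))) (by
    intro f g
    ext1
    funext k
    change coords τ c b (h.transferMap^[k] (f + g)) = _
    rw [iterate_map_add, map_add]
    rfl))

/-- On the span, coordinates determine the function; so if they vanish at one late k, then L^k f =
0. -/
theorem toLimit_eq_zero_iff (hb : IsMarkovPartition τ c b) (h : IsUnimodal τ c)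
    (hs : Function.Surjective τ) (f : C(DiscSpace τ c, ℤ)) :
    hb.toLimit h hs f = 0 ↔ f ∈ eventualKer (sigma τ c) h.isPiecewiseHomeo := by
  have : hb.toLimit h hs f = 0 ↔ ∀ᶠ k in atTop, coords τ c b (h.transferMap^[k] f) = 0 :=
    QuotientAddGroup.eq_zero_iff _
  rw [this]
  constructor
  · intro hf
    obtain ⟨k, hk, hk'⟩ := (hf.and (hb.eventually_iterate_mem h hs f)).exists
    refine ⟨k, ?_⟩
    rw [← hb.sum_smul_pieceFun_coords hk', hk]
    simp
  · rintro ⟨m, hm⟩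
    filter_upwards [eventually_ge_atTop m] with k hk
    obtain ⟨l, rfl⟩ := Nat.exists_eq_add_of_le' hk
    rw [Function.iterate_add_apply, hm, iterate_map_zero, map_zero]

/-- Realize a late term of the sequence in the span and take an N-fold preimage under L. Preimages
preserve nonnegativity, so one construction gives surjectivity and the lifting of positive elements.
-/
theorem exists_toLimit_eq (hb : IsMarkovPartition τ c b) (h : IsUnimodal τ c)
    (hs : Function.Surjective τ) (g : eventuallyCompatible (rightMul (incidenceMatrix τ c b))) :
    ∃ f, hb.toLimit h hs f = QuotientAddGroup.mk g ∧
      ((∀ᶠ k in atTop, 0 ≤ (g : ℕ → Fin n → ℤ) k) → 0 ≤ f) := by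
  have hg : ∀ᶠ k in atTop, rightMul (incidenceMatrix τ c b) ((g : ℕ → Fin n → ℤ) k) =
    (g : ℕ → Fin n → ℤ) (k + 1) := g.2
  -- A single N must serve both purposes: compatibility from N on, and a nonnegative term at N when
  -- the sequence is eventually nonnegative.
  have hex : ∃ N : ℕ, (∀ k ≥ N, rightMul (incidenceMatrix τ c b) ((g : ℕ → Fin n → ℤ) k) =
      (g : ℕ → Fin n → ℤ) (k + 1)) ∧
      ((∀ᶠ k in atTop, 0 ≤ (g : ℕ → Fin n → ℤ) k) → 0 ≤ (g : ℕ → Fin n → ℤ) N) := by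
    obtain ⟨N, hN⟩ := eventually_atTop.1 hg
    by_cases hpos : ∀ᶠ k in atTop, 0 ≤ (g : ℕ → Fin n → ℤ) k
    · obtain ⟨M, hM⟩ := eventually_atTop.1 hpos
      exact ⟨max N M, fun k hk => hN k ((le_max_left _ _).trans hk),
        fun _ => hM _ (le_max_right _ _)⟩
    · exact ⟨N, hN, fun h' => absurd h' hpos⟩
  obtain ⟨N, hN, hpos⟩ := hex
  obtain ⟨f, hf, hf0⟩ := h.exists_nonneg_iterate_eq hs N
    (∑ i, (g : ℕ → Fin n → ℤ) N i • hb.pieceFun i)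
  have hfN : h.transferMap^[N] f ∈ stepSpan τ c (range b) :=
    hf ▸ sum_mem fun i _ => zsmul_mem (hb.pieceFun_mem i) _
  refine ⟨f, ?_, fun hg0 => hf0 fun p => ?_⟩
  · have key : ∀ k ≥ N, coords τ c b (h.transferMap^[k] f) = (g : ℕ → Fin n → ℤ) k := by
      intro k hk
      induction k, hk using Nat.le_induction with
      | base => rw [hf, hb.coords_sum_smul_pieceFun]
      | succ k hk ih =>
        rw [Function.iterate_succ_apply', hb.coords_transferMap h hs
          (h.iterate_mem_stepSpan hs (hb.mapsTo_range h) hb.zero_mem_range hb.one_mem_range hk hfN),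
          ih, hN k hk]
    refine QuotientAddGroup.eq_iff_sub_mem.2 ?_
    change ∀ᶠ k in atTop, coords τ c b (h.transferMap^[k] f) - (g : ℕ → Fin n → ℤ) k = 0
    filter_upwards [eventually_ge_atTop N] with k hk
    rw [key k hk, sub_self]
  · obtain ⟨j, hj⟩ := hb.exists_mem_markovPiece p
    exact (hpos hg0 j).trans_eq (hb.sum_smul_pieceFun_apply _ hj).symm

/-- The dimension triple of a surjective unimodal map is given by the incidence matrix of any Markov
partition. -/
theorem tripleIso (hb : IsMarkovPartition τ c b) (h : IsUnimodal τ c)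
    (hs : Function.Surjective τ) :
    TripleIso (DG.posCone h) (DG.star h) (MatrixDimGroup.posCone (incidenceMatrix τ c b))
      (MatrixDimGroup.star (incidenceMatrix τ c b)) := by
  let φ : DG h →+ MatrixDimGroup (incidenceMatrix τ c b) :=
    QuotientAddGroup.lift _ (hb.toLimit h hs) fun f hf => (hb.toLimit_eq_zero_iff h hs f).2 hf
  have hφ : ∀ f : C(DiscSpace τ c, ℤ), φ (QuotientAddGroup.mk f) = hb.toLimit h hs f :=
    fun f => rfl
  have hbij : Function.Bijective φ := by
    constructor
    · rw [injective_iff_map_eq_zero]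
      intro x
      induction x using QuotientAddGroup.induction_on with
      | H f =>
        intro hf
        exact (QuotientAddGroup.eq_zero_iff f).2 ((hb.toLimit_eq_zero_iff h hs f).1 hf)
    · intro y
      induction y using QuotientAddGroup.induction_on with
      | H g =>
        obtain ⟨f, hf, -⟩ := hb.exists_toLimit_eq h hs g
        exact ⟨QuotientAddGroup.mk f, hf⟩
  refine ⟨AddEquiv.ofBijective φ hbij, Subset.antisymm ?_ ?_, fun x => ?_⟩
  · rintro _ ⟨_, ⟨f, hf, rfl⟩, rfl⟩
    refine ⟨_, Eventually.of_forall fun k => ?_, rfl⟩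
    exact fun i => h.iterate_nonneg hf k (leftEnd τ c b i)
  -- A group isomorphism preserving positivity need not be onto the cone; the nonnegative lift
  -- supplies this direction.
  · rintro _ ⟨g, hg, rfl⟩
    obtain ⟨f, hf, hf0⟩ := hb.exists_toLimit_eq h hs g
    exact ⟨QuotientAddGroup.mk f, ⟨f, hf0 hg, rfl⟩, hf⟩
  · induction x using QuotientAddGroup.induction_on with
    | H f =>
      change hb.toLimit h hs (h.transferMap f) =
        MatrixDimGroup.star (incidenceMatrix τ c b) (hb.toLimit h hs f)
      refine QuotientAddGroup.eq_iff_sub_mem.2 ?_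
      change ∀ᶠ k in atTop, coords τ c b (h.transferMap^[k] (h.transferMap f)) -
        rightMul (incidenceMatrix τ c b) (coords τ c b (h.transferMap^[k] f)) = 0
      filter_upwards [hb.eventually_iterate_mem h hs f] with k hk
      rw [← Function.iterate_succ_apply, Function.iterate_succ_apply',
        hb.coords_transferMap h hs hk, sub_self]

end IsMarkovPartition

end IntervalDim

theorem theorem1p88 (τ : unitInterval → unitInterval) (c : unitInterval)
    (hτ : IsUnimodal τ c) (hsurj : Function.Surjective τ) :
    (letI : Module ℤ[T;T⁻¹] (DG hτ) := DG.module hτ hsurj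
     Submodule.span ℤ[T;T⁻¹]
        {DG.interval hτ 0 1 zero_mem_genOrbit one_mem_genOrbit zero_lt_one} = ⊤) ∧
    (IsEventuallyPeriodic τ c →
      IsMarkov τ c ∧
      ∀ (n : ℕ) (b : Fin (n + 1) → unitInterval), IsMarkovPartition τ c b →
        TripleIso (DG.posCone hτ) (DG.star hτ)
          (MatrixDimGroup.posCone (incidenceMatrix τ c b))
          (MatrixDimGroup.star (incidenceMatrix τ c b))) ∧
    (¬ IsEventuallyPeriodic τ c →
      ∃ Φ : DG hτ ≃+ ℤ[T;T⁻¹], ∀ x, Φ (DG.star hτ x) = LaurentPolynomial.T 1 * Φ x) := by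
  exact ⟨DG.span_interval hτ hsurj,
    fun hp => ⟨hτ.isMarkov hsurj hp, fun _ _ hb => hb.tripleIso hτ hsurj⟩,
    DG.exists_addEquiv_laurent hτ hsurj⟩
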